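/- A $\mathrm{MOD}_m$-circuit in a finite set of variables is a finite directed acyclic multigraph with a designated root. Its gates without incoming wires are the input gates, and each variable labels exactly one of them. Every other gate is labelled with a set $R\subseteq\mathbb Z_m$ and outputs $1$ if the sum of its inputs (with multiplicity) modulo $m$ lies in $R$, and $0$ otherwise. The size is the number of gates plus the number of wires, counted with multiplicity; the depth is the maximal number of wires on a path from an input gate to the root. For a group $\Gamma$ of permutations of the variables, the circuit is $\Gamma$-symmetric if every $\pi\in\Gamma$ extends to a permutation of the gates that preserves wire multiplicities and the sets $R$ and acts on the input gates as $\pi$ acts on the variables. For a tuple $\boldsymbol k=(k_1,\dots,k_h)$ of positive integers with $n=\prod_i k_i$, let $\mathcal T_n^{\boldsymbol k}$ be the rooted tree with levels $0,\dots,h$ (root on level $h$, leaves on level $0$) in which each node on level $i\ge 1$ has $k_i$ children. Its $n$ leaves are the input variables, and $\mathbf{Aut}(\mathcal T_n^{\boldsymbol k})$ acts on them. Put $k_{\max}=\max_i k_i$, and call a circuit a $\boldsymbol k$-circuit if it is an $\mathbf{Aut}(\mathcal T_n^{\boldsymbol k})$-symmetric $\mathrm{MOD}_m$-circuit that computes $\mathrm{AND}_n$.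 Theorem. Let $m$ be an integer with exactly $r\ge 2$ distinct prime divisors and let $h\ge 1$. There are constants $c,C,K>0$, depending only on $m$ and $h$, such that the following holds for all integers $n\ge 2$ (logarithms to base $2$). 1. For every $\boldsymbol k\in\mathbb N^h$ with $\prod_i k_i=n$, every $\boldsymbol k$-circuit has size at least $2^{c\,k_{\max}^{1/r}\log k_{\max}}$, and there is a $\boldsymbol k$-circuit of depth $2h$ and size at most $2^{C\,k_{\max}^{1/r}\log k_{\max}}$. 2. For every such $\boldsymbol k$ we have $k_{\max}\ge n^{1/h}$, with equality if and only if $k_1=\dots=k_h=n^{1/h}$. 3. For every such $\boldsymbol k$, every $\boldsymbol k$-circuit has size at least $2^{c\,n^{1/(hr)}\log n}$. 4. If $n^{1/h}$ is an integer and $\boldsymbol k=(n^{1/h},\dots,n^{1/h})$, then there is a $\boldsymbol k$-circuit $D$ of depth $2h$ with $2^{c\,n^{1/(hr)}\log n}\le|D|\le 2^{C\,n^{1/(hr)}\log n}$. Moreover, for every $\boldsymbol k'\in\mathbb N^h$ with $\prod_i k'_i=n$ and every $\boldsymbol k'$-circuit $E$, we have $|D|\le|E|^{K}$. Thus, up to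 a constant factor in the exponent, the choice $k_1=\dots=k_h=n^{1/h}$ minimises the size of an $\mathbf{Aut}(\mathcal T_n^{\boldsymbol k})$-symmetric $\mathrm{MOD}_m$-circuit for $\mathrm{AND}_n$, and the minimal size is then $2^{\Theta(n^{1/(hr)}\log n)}$, attained in depth $2h$. -/

import Mathlib

open scoped BigOperators Classical

/-! ### The symmetric rooted tree with prescribed block sizes, and its automorphism group -/

/-- The nodes of the rooted tree with levels `0, …, h` (the root is the only node on level `h`,
the leaves are on level `0`) in which every node on level `j + 1` has `k j` children.
A node on level `i` is the list of choices made on the way down from the root: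
one choice among `k j` children for every step from level `j + 1` to level `j`, `i ≤ j < h`. -/
def BlockTree {h : ℕ} (k : Fin h → ℕ) : Type :=
  Σ i : Fin (h + 1), ((j : {j : Fin h // (i : ℕ) ≤ (j : ℕ)}) → Fin (k j.1))

namespace BlockTree

variable {h : ℕ} {k : Fin h → ℕ}

/-- `IsParent u v`: there is an edge of the rooted tree from `u` down to its child `v`. -/
def IsParent (u v : BlockTree k) : Prop :=
  (u.1 : ℕ) = (v.1 : ℕ) + 1 ∧
    ∀ (j : Fin h) (hu : (u.1 : ℕ) ≤ (j : ℕ)) (hv : (v.1 : ℕ) ≤ (j : ℕ)),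
      u.2 ⟨j, hu⟩ = v.2 ⟨j, hv⟩

/-- The leaves of the tree. There are `∏ i, k i` of them; they serve as the input variables. -/
abbrev Leaf (k : Fin h → ℕ) : Type := (i : Fin h) → Fin (k i)

/-- A leaf as a node (on level `0`) of the tree. -/
def ofLeaf (x : Leaf k) : BlockTree k := ⟨0, fun j => x j.1⟩

/-- The automorphism group of the rooted tree (permutations of all the nodes that preserve edges
and non-edges), embedded into the symmetric group on the leaves: the group of all permutations of
the leaves that are induced by an automorphism of the tree. -/
def autLeaf (k : Fin h → ℕ) : Subgroup (Equiv.Perm (Leaf k)) where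
  carrier := {π | ∃ φ : (IsParent (k := k)) ≃r (IsParent (k := k)),
    ∀ x : Leaf k, φ (ofLeaf x) = ofLeaf (π x)}
  mul_mem' := by
    rintro a b ⟨φ, hφ⟩ ⟨ψ, hψ⟩
    exact ⟨ψ.trans φ, fun x => by simp [hφ, hψ]⟩
  one_mem' := ⟨RelIso.refl _, fun x => rfl⟩
  inv_mem' := by
    rintro a ⟨φ, hφ⟩
    refine ⟨φ.symm, fun x => ?_⟩
    rw [RelIso.symm_apply_eq, hφ]
    simp

end BlockTree

/-! ### Modular circuits -/

/-- A `MOD_m`-circuit in the variables `X`: a finite directed acyclic multigraph of gates with a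
designated root. A gate is labelled either with a variable, or with a set `R` of residues
modulo `m`, the latter standing for the operation `MOD_m^R`. -/
structure ModCircuit (m : ℕ) (X : Type) where
  Gate : Type
  [fintypeGate : Fintype Gate]
  /-- `wires g g'` is the multiplicity of the edge from `g` to `g'`,
  along which the value of `g` is fed into `g'`. -/
  wires : Gate → Gate → ℕ
  label : Gate → X ⊕ Set (ZMod m)
  root : Gate
  /-- There is no directed cycle. -/
  acyclic : WellFounded fun g g' => 0 < wires g g'
  /-- The gates labelled with variables are the gates without incoming wires. -/
  isInput_iff : ∀ g, (∃ x, label g = Sum.inl x) ↔ ∀ g', wires g' g = 0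
  /-- For every variable there is exactly one input gate. -/
  existsUnique_input : ∀ x, ∃! g, label g = Sum.inl x

attribute [instance] ModCircuit.fintypeGate

namespace ModCircuit

variable {m : ℕ} {X : Type}

/-- Number of gates plus number of wires, counted with multiplicities. -/
def size (C : ModCircuit m X) : ℕ :=
  Fintype.card C.Gate + ∑ g : C.Gate, ∑ g' : C.Gate, C.wires g g'

/-- The Boolean value that the gate `g` computes on the assignment `a`
(see `eval_input` and `eval_mod`). -/
noncomputable def eval (C : ModCircuit m X) (a : X → Bool) : C.Gate → Bool :=
  C.acyclic.fix fun g val =>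
    Sum.elim a
      (fun R => decide
        (((∑ g' : C.Gate, if hg : 0 < C.wires g' g then C.wires g' g * (val g' hg).toNat else 0 : ℕ) :
          ZMod m) ∈ R))
      (C.label g)

theorem eval_input (C : ModCircuit m X) (a : X → Bool) {g : C.Gate} {x : X}
    (hg : C.label g = Sum.inl x) : C.eval a g = a x := by
  rw [eval, WellFounded.fix_eq, hg, Sum.elim_inl]

/-- `MOD_m^R` outputs `1` iff the sum of its inputs, counted with multiplicities, lies in `R`
modulo `m`. -/
theorem eval_mod (C : ModCircuit m X) (a : X → Bool) {g : C.Gate} {R : Set (ZMod m)}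
    (hg : C.label g = Sum.inr R) :
    C.eval a g = true ↔
      ((∑ g' : C.Gate, C.wires g' g * (C.eval a g').toNat : ℕ) : ZMod m) ∈ R := by
  rw [eval, WellFounded.fix_eq, hg, Sum.elim_inr, decide_eq_true_iff, ← eval]
  have : ∀ g' : C.Gate,
      (if _ : 0 < C.wires g' g then C.wires g' g * (C.eval a g').toNat else 0) =
        C.wires g' g * (C.eval a g').toNat := by
    intro g'
    split_ifs with h0
    · rfl
    · simp [Nat.eq_zero_of_not_pos h0]
  simp only [this]

/-- The circuit computes the conjunction of all its variables. -/
def ComputesAnd (C : ModCircuit m X) : Prop :=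
  ∀ a : X → Bool, C.eval a C.root = true ↔ ∀ x, a x = true

/-- The maximal number of wires on a directed path that ends in the gate `g`
(see `depthAt_eq`). -/
noncomputable def depthAt (C : ModCircuit m X) : C.Gate → ℕ :=
  C.acyclic.fix fun g d =>
    Finset.univ.sup fun g' : C.Gate => if hg : 0 < C.wires g' g then d g' hg + 1 else 0

theorem depthAt_eq (C : ModCircuit m X) (g : C.Gate) :
    C.depthAt g =
      Finset.univ.sup fun g' : C.Gate => if 0 < C.wires g' g then C.depthAt g' + 1 else 0 := by
  rw [depthAt, WellFounded.fix_eq]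
  congr 1

/-- The maximal number of wires on a path between the root and an input gate. -/
noncomputable def depth (C : ModCircuit m X) : ℕ := C.depthAt C.root

/-- The permutation `σ` of the gates is an automorphism of the circuit that extends the
permutation `π` of the variables: it preserves all edge multiplicities and the operations of the
internal gates, and permutes the input gates as `π` permutes the variables. -/
def Extends (C : ModCircuit m X) (π : Equiv.Perm X) (σ : Equiv.Perm C.Gate) : Prop :=
  (∀ g, C.label (σ g) = Sum.map π id (C.label g)) ∧
    ∀ g g', C.wires (σ g) (σ g') = C.wires g g'

/-- `Γ`-symmetric circuits: every permutation in `Γ` extends to an automorphism. -/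
def IsSymmetric (C : ModCircuit m X) (Γ : Subgroup (Equiv.Perm X)) : Prop :=
  ∀ π ∈ Γ, ∃ σ : Equiv.Perm C.Gate, C.Extends π σ

end ModCircuit

/-- `C` is a `MOD_m`-circuit that computes the conjunction of the leaves of the tree with block
sizes `k` and is symmetric under the automorphism group of that tree. -/
def IsBlockSymmetricAnd {m h : ℕ} {k : Fin h → ℕ} (C : ModCircuit m (BlockTree.Leaf k)) : Prop :=
  C.IsSymmetric (BlockTree.autLeaf k) ∧ C.ComputesAnd

/-- The largest block size. -/
def maxBlock {h : ℕ} (k : Fin h → ℕ) : ℕ := Finset.univ.sup k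

/-! Lower bound. Let `κ` be the largest block size and let `Sym(κ)` act on the leaves through that
one coordinate. In a symmetric circuit with fewer than `a!` gates, the permutations that have an
extension fixing a given gate form a subgroup of index less than `a!`. Such a subgroup contains the
alternating group on all but fewer than `3 * a` points (`exists_large_triRel_class`), and the whole
alternating group once it contains a permutation without short cycles
(`alternatingGroup_le_of_long_cycles`). Applied to the root, this gives a set `B` whose alternating
group fixes the root; its size `M` can be chosen divisible by a power of each prime of `m` exceeding
`a` by a constant factor, which needs `κ` of order `a ^ r`. Now compare the all-ones assignment with
the one that is zero exactly at coordinates in `B`. Inductively, no gate fixed by `Alt(B)`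
distinguishes them (`eval_eq_of_alternatingGroup_le`): an even permutation with long `p`-power
cycles groups the inputs of the gate into orbits, and an orbit of length not divisible by `p ^ α`
consists of gates again fixed by `Alt(B)`, whose values agree. So the input sums agree modulo `m`,
whereas the conjunction does distinguish the assignments. Hence there are at least `a!` gates with
`a` of order `κ ^ (1 / r)`.

Upper bound. Each tree node computes the conjunction of its children in depth 2. Choose prime powers
`p ^ e` of order `κ ^ (1 / r)` with product exceeding `κ`; then all children are true iff every `p ^
e` divides the number `z` of zeros. Modulo `p`, this divisibility is an alternating sum of `z.choose
j` with `j < p ^ e` (`altChoose_prime_pow`), hence an affine combination of disjunctions over small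
sets of children (`sum_powerset_or`). Modulo `p`, a disjunction is in turn a multiple of the number
of linear forms over another prime `q` that take the value 1 (`card_forms_eq_one`). There are only
`2 ^ O(κ ^ (1 / r) * log κ)` such forms.

Since `κ ≥ n ^ (1 / h)`, with equality for equal blocks only, the remaining claims follow. -/

/-! ### Subgroups of small index in a symmetric group -/

namespace Equiv.Perm

variable {Ω : Type*} [DecidableEq Ω]

/-- The permutation `x ↦ y ↦ z ↦ x`. -/
def tricycle (x y z : Ω) : Equiv.Perm Ω := Equiv.swap x z * Equiv.swap x y

theorem tricycle_conj (ρ : Equiv.Perm Ω) (x y z : Ω) :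
    ρ * tricycle x y z * ρ⁻¹ = tricycle (ρ x) (ρ y) (ρ z) := by
  have h1 : ∀ a b, Equiv.swap (ρ a) (ρ b) = ρ * Equiv.swap a b * ρ⁻¹ := fun a b =>
    Equiv.swap_apply_apply ρ a b
  simp only [tricycle, h1]
  group

theorem tricycle_rotate {x y z : Ω} (hxy : x ≠ y) (hyz : y ≠ z) (hxz : x ≠ z) :
    tricycle x y z = tricycle y z x := by
  ext w
  simp only [tricycle, Equiv.Perm.mul_apply, Equiv.swap_apply_def]
  grind

theorem tricycle_inv {x y z : Ω} (hxy : x ≠ y) (hyz : y ≠ z) (hxz : x ≠ z) :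
    (tricycle x y z)⁻¹ = tricycle y x z := by
  rw [inv_eq_iff_mul_eq_one]
  ext w
  simp only [tricycle, Equiv.Perm.mul_apply, Equiv.swap_apply_def, Equiv.Perm.one_apply]
  grind

theorem tricycle_apply_of_ne {x y z w : Ω} (hx : w ≠ x) (hy : w ≠ y) (hz : w ≠ z) :
    tricycle x y z w = w := by
  simp [tricycle, Equiv.swap_apply_of_ne_of_ne, hx, hy, hz]

theorem tricycle_fst {x y z : Ω} (hxy : x ≠ y) (hyz : y ≠ z) :
    tricycle x y z x = y := by
  simp only [tricycle, Equiv.Perm.mul_apply, Equiv.swap_apply_def]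
  grind

theorem IsThreeCycle.exists_eq_tricycle [Fintype Ω] {σ : Equiv.Perm Ω} (h : σ.IsThreeCycle) :
    ∃ x y z, x ≠ y ∧ y ≠ z ∧ x ≠ z ∧ x ∈ σ.support ∧ y ∈ σ.support ∧ z ∈ σ.support ∧
      σ = tricycle x y z := by
  obtain ⟨a, ha⟩ : σ.support.Nonempty := by
    rw [← Finset.card_pos, h.card_support]; norm_num
  have hn := h.nodup_iff_mem_support.2 ha
  have he := h.eq_swap_mul_swap_iff_mem_support.2 ha
  have h1 : σ a ∈ σ.support := Equiv.Perm.apply_mem_support.2 ha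
  have h2 : σ (σ a) ∈ σ.support := Equiv.Perm.apply_mem_support.2 h1
  refine ⟨a, σ a, σ (σ a), by grind, by grind, by grind, ha, h1, h2, ?_⟩
  refine he.trans ?_
  ext w
  generalize σ (σ a) = c at *
  generalize σ a = b at *
  simp only [tricycle, Equiv.Perm.mul_apply, Equiv.swap_apply_def]
  grind

/-- Two permutations whose supports meet in a single point have a 3-cycle as commutator. -/
theorem commutator_eq_tricycle {U V : Set Ω} {x : Ω} {g h : Equiv.Perm Ω}
    (hUV : _root_.Disjoint U V) (hxU : x ∉ U) (hxV : x ∉ V)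
    (hg : ∀ w, w ∉ U → w ≠ x → g w = w) (hh : ∀ w, w ∉ V → w ≠ x → h w = w)
    (hgx : g x ≠ x) (hhx : h x ≠ x) :
    g * h * g⁻¹ * h⁻¹ = tricycle x (g x) (h x) := by
  have hg' : ∀ w, w ∉ U → w ≠ x → g⁻¹ w = w := fun w h1 h2 => by
    rw [Equiv.Perm.inv_eq_iff_eq, hg w h1 h2]
  have hh' : ∀ w, w ∉ V → w ≠ x → h⁻¹ w = w := fun w h1 h2 => by
    rw [Equiv.Perm.inv_eq_iff_eq, hh w h1 h2]
  have hdis : ∀ w, w ∈ U → w ∉ V := fun w a b => Set.disjoint_left.1 hUV a b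
  have ig : ∀ w, g (g⁻¹ w) = w := fun w => by simp
  have ih : ∀ w, h (h⁻¹ w) = w := fun w => by simp
  have ig2 : ∀ w, g⁻¹ (g w) = w := fun w => by simp
  have ih2 : ∀ w, h⁻¹ (h w) = w := fun w => by simp
  have gU : g x ∈ U := by by_contra hc; have := hg (g x) hc hgx; exact hgx (g.injective this)
  have hV : h x ∈ V := by by_contra hc; have := hh (h x) hc hhx; exact hhx (h.injective this)
  ext w
  simp only [tricycle, Equiv.Perm.mul_apply, Equiv.swap_apply_def]
  have a1 := hdis (g x) gU
  by_cases hwx : w = x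
  · subst hwx
    have : h⁻¹ w ∈ V := by
      by_contra hc
      by_cases h2 : h⁻¹ w = w
      · apply hhx; nth_rw 1 [← h2]; exact ih w
      · have := hh _ hc h2; rw [ih] at this; exact h2 this.symm
    have h3 : h⁻¹ w ∉ U := fun hc => hdis _ hc this
    have h4 : h⁻¹ w ≠ w := fun hc => hxV (hc ▸ this)
    rw [hg' _ h3 h4, ih]
    grind
  by_cases hwV : w ∈ V
  · have hwU : w ∉ U := fun hc => hdis _ hc hwV
    by_cases hwz : w = h x
    · subst hwz
      rw [ih2]
      have : g⁻¹ x ∈ U := by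
        by_contra hc
        by_cases h2 : g⁻¹ x = x
        · apply hgx; nth_rw 1 [← h2]; exact ig x
        · have := hg _ hc h2; rw [ig] at this; exact h2 this.symm
      rw [hh _ (hdis _ this) (fun hc => hxU (hc ▸ this)), ig]
      grind
    · have h5 : h⁻¹ w ≠ x := fun hc => hwz (by rw [← hc, ih])
      have h6 : h⁻¹ w ∈ V := by
        by_contra hc
        have := hh _ hc h5; rw [ih] at this; rw [← this] at hc; exact hc hwV
      rw [hg' _ (fun hc => hdis _ hc h6) h5, ih, hg _ hwU hwx]
      grind
  · rw [hh' w hwV hwx]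
    by_cases hwU : w ∈ U
    · by_cases hwy : w = g x
      · subst hwy
        rw [ig2]
        have h7 : h x ∉ U := fun hc => hdis _ hc hV
        rw [hg _ h7 hhx]
        grind
      · have h5 : g⁻¹ w ≠ x := fun hc => hwy (by rw [← hc, ig])
        have h6 : g⁻¹ w ∈ U := by
          by_contra hc
          have := hg _ hc h5; rw [ig] at this; rw [← this] at hc; exact hc hwU
        rw [hh _ (hdis _ h6) h5, ig]
        grind
    · rw [hg' w hwU hwx, hh w hwV hwx, hg w hwU hwx]
      grind

/-- Two points are related if they coincide or lie on a common 3-cycle from `H`. -/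
def TriRel (H : Subgroup (Equiv.Perm Ω)) (x y : Ω) : Prop :=
  x = y ∨ ∃ z, x ≠ y ∧ y ≠ z ∧ x ≠ z ∧ tricycle x y z ∈ H

variable {H : Subgroup (Equiv.Perm Ω)}

theorem TriRel.symm {x y : Ω} (h : TriRel H x y) : TriRel H y x := by
  obtain rfl | ⟨z, h1, h2, h3, h4⟩ := h
  · exact Or.inl rfl
  · refine Or.inr ⟨z, h1.symm, h3, h2, ?_⟩
    rw [← tricycle_inv h1 h2 h3]
    exact H.inv_mem h4

/-- Conjugating `(x y z)` by `(y w v)` fixes `x` and carries `y` to `w`, unless `v = x`; in that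
case the inverse of the second cycle already joins `x` to `w`. -/
theorem TriRel.trans {x y w : Ω} (h : TriRel H x y) (h' : TriRel H y w) : TriRel H x w := by
  obtain rfl | ⟨z, h1, h2, h3, h4⟩ := h
  · exact h'
  obtain rfl | ⟨v, k1, k2, k3, k4⟩ := h'
  · exact Or.inr ⟨z, h1, h2, h3, h4⟩
  by_cases hxw : x = w
  · exact Or.inl hxw
  by_cases hxv : x = v
  · subst hxv
    refine Or.inr ⟨y, hxw, k1.symm, h1, ?_⟩
    rw [tricycle_rotate hxw k1.symm h1, ← tricycle_inv k1 k2 k3]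
    exact H.inv_mem k4
  · have := H.mul_mem (H.mul_mem k4 h4) (H.inv_mem k4)
    rw [tricycle_conj, tricycle_apply_of_ne h1 hxw hxv, tricycle_fst k1 k2] at this
    refine Or.inr ⟨_, hxw, ?_, ?_, this⟩
    · intro hc
      apply h2
      apply (tricycle y w v).injective
      rw [← hc, tricycle_fst k1 k2]
    · intro hc
      apply h3
      apply (tricycle y w v).injective
      rw [← hc, tricycle_apply_of_ne h1 hxw hxv]

theorem TriRel.map {x y : Ω} (h : TriRel H x y) {σ : Equiv.Perm Ω} (hσ : σ ∈ H) :
    TriRel H (σ x) (σ y) := by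
  obtain rfl | ⟨z, h1, h2, h3, h4⟩ := h
  · exact Or.inl rfl
  · refine Or.inr ⟨σ z, by simpa, by simpa, by simpa, ?_⟩
    rw [← tricycle_conj]
    exact H.mul_mem (H.mul_mem hσ h4) (H.inv_mem hσ)

/-- With cycles `(x y u)` and `(u z v)` in `H`, conjugating the first by the second replaces `u` by
`z`. If `v` is `x` or `y`, conjugation by the inverse works instead, up to inverting the result.
Thus `H` contains the alternating group on every class of `TriRel`. -/
theorem TriRel.tricycle_mem {x y z : Ω} (hxy : x ≠ y) (hyz : y ≠ z) (hxz : x ≠ z)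
    (h1 : TriRel H x y) (h2 : TriRel H x z) : tricycle x y z ∈ H := by
  obtain h | ⟨u, -, hyu, hxu, hu⟩ := h1
  · exact absurd h hxy
  by_cases huz : u = z
  · rwa [← huz]
  have h3 : TriRel H u x := (Or.inr ⟨y, hxu.symm, hxy, hyu.symm, by
    rw [tricycle_rotate hxu.symm hxy hyu.symm]; exact hu⟩)
  obtain h | ⟨v, -, hzv, huv, hv⟩ := h3.trans h2
  · exact absurd h huz
  by_cases hvx : v = x
  · subst hvx
    have := H.mul_mem (H.mul_mem (H.inv_mem hv) hu) (H.inv_mem (H.inv_mem hv))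
    rw [tricycle_inv huz hzv huv, tricycle_conj] at this
    have e1 : tricycle z u v v = z := by simp [tricycle]; grind
    have e2 : tricycle z u v u = v := by simp [tricycle]
    have e3 : tricycle z u v y = y := tricycle_apply_of_ne hyz hyu hxy.symm
    rw [e1, e2, e3] at this
    have := H.inv_mem this
    rw [tricycle_inv hyz.symm hxy.symm hzv] at this
    rwa [← tricycle_rotate hxy hyz hzv.symm] at this
  by_cases hvy : v = y
  · subst hvy
    have := H.mul_mem (H.mul_mem (H.inv_mem hv) hu) (H.inv_mem (H.inv_mem hv))
    rw [tricycle_inv huz hzv huv, tricycle_conj] at this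
    have e1 : tricycle z u v v = z := by simp [tricycle]; grind
    have e2 : tricycle z u v u = v := by simp [tricycle]
    have e3 : tricycle z u v x = x := tricycle_apply_of_ne hxz hxu hxy
    rw [e1, e2, e3] at this
    have := H.inv_mem this
    rw [tricycle_inv hxz hzv hxy] at this
    rwa [tricycle_rotate hxz.symm hxy hzv] at this
  · have := H.mul_mem (H.mul_mem hv hu) (H.inv_mem hv)
    rw [tricycle_conj, tricycle_fst huz hzv, tricycle_apply_of_ne hxu hxz (Ne.symm hvx),
      tricycle_apply_of_ne hyu hyz (Ne.symm hvy)] at this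
    exact this

end Equiv.Perm

/-! ### Large alternating groups inside subgroups of small index. -/

namespace Equiv.Perm

variable {Ω : Type*} [DecidableEq Ω]

-- By unimodality of the binomial coefficients the extreme case is `b = a`, where `n.choose a * a!`
-- is at least `(n + 1 - a) ^ a ≥ (a * a) ^ a ≥ a! * a!`.
open scoped Nat in
theorem factorial_le_choose {n a b : ℕ} (hn : a * a + a ≤ n) (hab : a ≤ b) (hbn : b + a ≤ n) :
    a ! ≤ n.choose b := by
  have base : a ! ≤ n.choose a := by
    have h1 : a ! * a ! ≤ a ! * n.choose a := by
      rw [← Nat.descFactorial_eq_factorial_mul_choose]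
      calc a ! * a ! ≤ a ^ a * a ^ a :=
            Nat.mul_le_mul (Nat.factorial_le_pow a) (Nat.factorial_le_pow a)
        _ = (a * a) ^ a := by rw [mul_pow]
        _ ≤ (n + 1 - a) ^ a := Nat.pow_le_pow_left (by omega) a
        _ ≤ n.descFactorial a := Nat.pow_sub_le_descFactorial n a
    exact Nat.le_of_mul_le_mul_left h1 (Nat.factorial_pos a)
  have low : ∀ c, a ≤ c → c ≤ n / 2 → a ! ≤ n.choose c := by
    intro c hac
    induction c, hac using Nat.le_induction with
    | base => exact fun _ => base
    | succ c hc ih =>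
      intro h
      exact (ih (by omega)).trans (Nat.choose_le_succ_of_lt_half_left (by omega))
  rcases le_or_gt b (n / 2) with h | h
  · exact low b hab h
  · rw [← Nat.choose_symm (by omega : b ≤ n)]
    exact low (n - b) (by omega) (by omega)

theorem card_le_index {α : Type*} [Finite α] {H : Subgroup (Equiv.Perm α)} {ι : Type*} [Fintype ι]
    (f : ι → Equiv.Perm α) (hf : ∀ i j, (f i)⁻¹ * f j ∈ H → i = j) :
    Fintype.card ι ≤ H.index := by
  rw [Subgroup.index, ← Nat.card_eq_fintype_card]
  refine Nat.card_le_card_of_injective (fun i => (f i : Equiv.Perm α ⧸ H)) fun i j hij => ?_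
  exact hf i j (QuotientGroup.eq.1 hij)

/-- Only the identity of `H` moves nothing outside of `U`. -/
def TrivialOn (H : Subgroup (Equiv.Perm Ω)) (U : Finset Ω) : Prop :=
  ∀ σ ∈ H, (∀ w, w ∉ U → σ w = w) → σ = 1

-- Distinct permutations supported in `U` lie in distinct cosets of `H`.
open scoped Nat in
theorem TrivialOn.factorial_card_le [Finite Ω] {H : Subgroup (Equiv.Perm Ω)} {U : Finset Ω}
    (h : TrivialOn H U) : (U.card)! ≤ H.index := by
  have := card_le_index (H := H) (fun σ : Equiv.Perm U => Equiv.Perm.ofSubtype σ) ?_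
  · rwa [Fintype.card_perm, Fintype.card_coe] at this
  · intro σ τ hστ
    have := h _ hστ fun w hw => by
      rw [Equiv.Perm.mul_apply, Equiv.Perm.ofSubtype_apply_of_not_mem τ hw,
        Equiv.Perm.inv_eq_iff_eq, Equiv.Perm.ofSubtype_apply_of_not_mem σ hw]
    rw [inv_mul_eq_one] at this
    exact Equiv.Perm.ofSubtype_injective this

/-- Every `Y ⊆ A` with as many points as `Z` is the image of `Z` under a permutation supported in
`A`. Two such permutations in the same coset differ by an element of `H` that preserves `Z`, so they
have the same image. -/
theorem choose_le_index [Fintype Ω] {H : Subgroup (Equiv.Perm Ω)} {A Z : Finset Ω} (hZA : Z ⊆ A)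
    (h : ∀ σ ∈ H, (∀ w, w ∉ A → σ w = w) → ∀ z ∈ Z, σ z ∈ Z) :
    (A.card).choose Z.card ≤ H.index := by
  have key : ∀ Y ∈ A.powersetCard Z.card, ∃ σ : Equiv.Perm Ω, (∀ w, w ∉ A → σ w = w) ∧
      Z.map σ.toEmbedding = Y := by
    intro Y hY
    rw [Finset.mem_powersetCard] at hY
    obtain ⟨hYA, hYc⟩ := hY
    have e1 : Fintype.card {x : A // (x : Ω) ∈ Z} = Fintype.card {x : A // (x : Ω) ∈ Y} := by
      have : ∀ T : Finset Ω, T ⊆ A → Fintype.card {x : A // (x : Ω) ∈ T} = T.card := by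
        intro T hT
        rw [← Fintype.card_coe]
        exact Fintype.card_congr
          ⟨fun x => ⟨x.1.1, x.2⟩, fun x => ⟨⟨x.1, hT x.2⟩, x.2⟩, fun _ => rfl, fun _ => rfl⟩
      rw [this Z hZA, this Y hYA, hYc]
    let e := (Fintype.equivOfCardEq e1).extendSubtype
    refine ⟨Equiv.Perm.ofSubtype e, fun w hw => Equiv.Perm.ofSubtype_apply_of_not_mem _ hw, ?_⟩
    refine Finset.eq_of_subset_of_card_le ?_ (by simp [hYc])
    intro y hy
    obtain ⟨z, hz, rfl⟩ := Finset.mem_map.1 hy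
    have : Equiv.Perm.ofSubtype e z = e ⟨z, hZA hz⟩ :=
      Equiv.Perm.ofSubtype_apply_of_mem e (hZA hz)
    simp only [Equiv.coe_toEmbedding, this]
    exact (Fintype.equivOfCardEq e1).extendSubtype_mem ⟨z, hZA hz⟩ hz
  choose! f hf1 hf2 using key
  have := card_le_index (H := H) (fun Y : A.powersetCard Z.card => f Y.1) ?_
  · rwa [Fintype.card_coe, Finset.card_powersetCard] at this
  · intro Y Y' hYY
    have hm := h _ hYY fun w hw => by
      rw [Equiv.Perm.mul_apply, hf1 _ Y'.2 w hw, Equiv.Perm.inv_eq_iff_eq, hf1 _ Y.2 w hw]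
    have hsub : Y'.1 ⊆ Y.1 := by
      intro y hy
      rw [← hf2 _ Y'.2] at hy
      obtain ⟨z, hz, rfl⟩ := Finset.mem_map.1 hy
      have := hm z hz
      rw [← hf2 _ Y.2]
      refine Finset.mem_map.2 ⟨_, this, ?_⟩
      simp
    have h1 := (Finset.mem_powersetCard.1 Y.2).2
    have h2 := (Finset.mem_powersetCard.1 Y'.2).2
    exact Subtype.ext (Finset.eq_of_subset_of_card_le hsub (by rw [h1, h2])).symm

theorem exists_maximal_trivialOn (H : Subgroup (Equiv.Perm Ω)) (W : Finset Ω) :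
    ∃ U ⊆ W, TrivialOn H U ∧ ∀ x ∈ W, x ∉ U → ¬ TrivialOn H (insert x U) := by
  obtain ⟨U, hU, hmax⟩ := Finset.exists_max_image (W.powerset.filter (TrivialOn H)) Finset.card
    ⟨∅, by
      simp only [Finset.mem_filter, Finset.mem_powerset, Finset.empty_subset, true_and]
      intro σ _ h
      ext w
      exact h w (by simp)⟩
  simp only [Finset.mem_filter, Finset.mem_powerset] at hU hmax
  refine ⟨U, hU.1, hU.2, fun x hx hxU hT => ?_⟩
  have := hmax (insert x U) ⟨Finset.insert_subset hx hU.1, hT⟩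
  rw [Finset.card_insert_of_notMem hxU] at this
  omega

theorem TrivialOn.exists_moving {H : Subgroup (Equiv.Perm Ω)} {U : Finset Ω} {x : Ω}
    (hU : TrivialOn H U) (hx : ¬ TrivialOn H (insert x U)) :
    ∃ σ ∈ H, (∀ w, w ∉ U → w ≠ x → σ w = w) ∧ σ x ≠ x := by
  simp only [TrivialOn, not_forall] at hx
  obtain ⟨σ, hσ, h1, h2⟩ := hx
  refine ⟨σ, hσ, fun w hw hwx => h1 w (by simp [hw, hwx]), fun hc => h2 (hU σ hσ fun w hw => ?_)⟩
  by_cases hwx : w = x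
  · rw [hwx, hc]
  · exact h1 w (by simp [hw, hwx])

open scoped Nat in
/-- A subgroup of index less than `a!` acts like the full alternating group on all but
fewer than `3 * a` points. -/
theorem exists_large_triRel_class [Fintype Ω] (H : Subgroup (Equiv.Perm Ω)) {a : ℕ}
    (hidx : H.index < a !) (hN : a * a + 6 * a ≤ Fintype.card Ω) :
    ∃ Δ : Finset Ω, Δᶜ.card < 3 * a ∧ (∀ x ∈ Δ, ∀ y ∈ Δ, TriRel H x y) ∧
      ∀ σ ∈ H, ∀ x ∈ Δ, σ x ∈ Δ := by
  have ha : 0 < a := by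
    rcases Nat.eq_zero_or_pos a with rfl | h
    · have : H.index ≠ 0 := Subgroup.index_ne_zero_of_finite
      simp at hidx; omega
    · exact h
  -- `U` and `V` are disjoint and have fewer than `a` points each. By maximality, every `x` outside
  -- both is moved by elements of `H` supported in `U ∪ {x}` and in `V ∪ {x}`; their commutator is a
  -- 3-cycle through `x` and a point of `U`. So the classes of fewer than `a` points cover `A`.
  obtain ⟨U, -, hU, hUmax⟩ := exists_maximal_trivialOn H Finset.univ
  obtain ⟨V, hVU, hV, hVmax⟩ := exists_maximal_trivialOn H Uᶜ
  have small : ∀ T, TrivialOn H T → T.card < a := fun T hT => by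
    by_contra! hc
    exact absurd ((Nat.factorial_le hc).trans hT.factorial_card_le) (not_le.2 hidx)
  set A : Finset Ω := (U ∪ V)ᶜ with hA
  have hAc : Fintype.card Ω < A.card + 2 * a := by
    have h1 := small U hU
    have h2 := small V hV
    have h3 := Finset.card_union_le U V
    have h4 := Finset.card_add_card_compl (U ∪ V)
    rw [← hA] at h4
    omega
  have rich : ∀ x ∈ A, ∃ u ∈ U, TriRel H u x := by
    intro x hx
    simp only [hA, Finset.mem_compl, Finset.mem_union, not_or] at hx
    obtain ⟨g, hg, hg1, hg2⟩ := hU.exists_moving (hUmax x (Finset.mem_univ x) hx.1)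
    obtain ⟨h, hh, hh1, hh2⟩ :=
      hV.exists_moving (hVmax x (Finset.mem_compl.2 hx.1) hx.2)
    have hd : _root_.Disjoint (U : Set Ω) (V : Set Ω) := by
      rw [Finset.disjoint_coe]
      exact Finset.disjoint_left.2 fun w h1 h2 => Finset.mem_compl.1 (hVU h2) h1
    have hc := commutator_eq_tricycle hd (by simpa using hx.1) (by simpa using hx.2)
      (by simpa using hg1) (by simpa using hh1) hg2 hh2
    have gU : g x ∈ U := by
      by_contra hc; exact hg2 (g.injective (hg1 (g x) hc hg2))
    have hV' : h x ∈ V := by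
      by_contra hc; exact hh2 (h.injective (hh1 (h x) hc hh2))
    refine ⟨g x, gU, TriRel.symm (Or.inr ⟨h x, hg2.symm, ?_, hh2.symm, ?_⟩)⟩
    · intro hgh
      rw [hgh] at gU
      exact Finset.mem_compl.1 (hVU hV') gU
    · rw [← hc]
      exact H.mul_mem (H.mul_mem (H.mul_mem hg hh) (H.inv_mem hg)) (H.inv_mem hh)
  -- the union of the classes of the points of `T`
  let Y : Finset Ω → Finset Ω := fun T => A.filter fun x => ∃ u ∈ T, TriRel H u x
  -- An element of `H` that moves only points of `A` fixes `U` pointwise, hence preserves the class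
  -- of every point of `U`. A union of classes of intermediate size would therefore force a large
  -- index.
  have dich : ∀ T ⊆ U, (Y T).card < a ∨ A.card < (Y T).card + a := by
    intro T hT
    by_contra! hc
    have h1 : (A.card).choose (Y T).card ≤ H.index := by
      refine choose_le_index (Finset.filter_subset _ _) fun σ hσ hfix z hz => ?_
      simp only [Y, Finset.mem_filter] at hz ⊢
      obtain ⟨hzA, u, hu, huz⟩ := hz
      have h2 := huz.map hσ
      have h3 : u ∉ A := by simp [hA, hT hu]
      rw [hfix u h3] at h2
      refine ⟨?_, u, hu, h2⟩
      by_contra hc2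
      have := σ.injective (hfix _ hc2)
      rw [this] at hc2
      exact hc2 hzA
    have h2 := factorial_le_choose (n := A.card) (a := a) (b := (Y T).card) (by omega) hc.1 hc.2
    omega
  -- If all classes were small, adding them one by one could never jump over the forbidden middle
  -- range, yet their union is `A`.
  have big : ∃ u ∈ U, A.card < (Y {u}).card + a := by
    by_contra! hc
    have hsmall : ∀ T : Finset Ω, T ⊆ U → (Y T).card < a := by
      intro T
      induction T using Finset.induction_on with
      | empty => intro _; simp [Y, ha]
      | insert u T hu ih =>
        intro hT
        have h1 : Y (insert u T) ⊆ Y {u} ∪ Y T := by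
          intro x hx
          simp only [Y, Finset.mem_filter, Finset.mem_union, Finset.mem_insert,
            Finset.mem_singleton] at hx ⊢
          grind
        have h2 := (Finset.card_le_card h1).trans (Finset.card_union_le _ _)
        have h3 := ih fun x hx => hT (Finset.mem_insert_of_mem hx)
        have h4 := hc u (hT (Finset.mem_insert_self u T))
        have h5 : (Y {u}).card < a := by
          rcases dich {u} (by simpa using hT (Finset.mem_insert_self u T)) with h | h
          · exact h
          · omega
        rcases dich _ hT with h | h
        · exact h
        · omega
    have h1 : A ⊆ Y U := fun x hx => by
      simp only [Y, Finset.mem_filter]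
      exact ⟨hx, rich x hx⟩
    have h2 := Finset.card_le_card h1
    have h3 := hsmall U (Finset.Subset.refl U)
    omega
  obtain ⟨u, hu, hbig⟩ := big
  set Δ : Finset Ω := Finset.univ.filter fun x => TriRel H u x with hΔ
  have hYΔ : (Y {u}).card ≤ Δ.card := Finset.card_le_card fun x hx => by
    simp only [Y, Finset.mem_filter, Finset.mem_singleton, exists_eq_left] at hx
    simp [hΔ, hx.2]
  have hcompl := Finset.card_add_card_compl Δ
  refine ⟨Δ, by omega, fun x hx y hy => ?_, fun σ hσ x hx => ?_⟩
  · simp only [hΔ, Finset.mem_filter, Finset.mem_univ, true_and] at hx hy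
    exact hx.symm.trans hy
  -- `Δ` contains more than half of the points, so it meets its image under `σ`; since `σ` maps
  -- classes into classes, it preserves `Δ`.
  · have : ∃ y ∈ Δ, σ y ∈ Δ := by
      by_contra! hc
      have h1 : Δ.map σ.toEmbedding ⊆ Δᶜ := by
        intro w hw
        obtain ⟨y, hy, rfl⟩ := Finset.mem_map.1 hw
        simpa using hc y hy
      have := Finset.card_le_card h1
      rw [Finset.card_map] at this
      omega
    obtain ⟨y, hy, hσy⟩ := this
    simp only [hΔ, Finset.mem_filter, Finset.mem_univ, true_and] at hx hy hσy ⊢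
    exact hσy.trans ((hy.symm.trans hx).map hσ)

open scoped Nat in
/-- A subgroup of small index that contains a permutation without short cycles contains the
alternating group. -/
theorem alternatingGroup_le_of_long_cycles [Fintype Ω] (H : Subgroup (Equiv.Perm Ω)) {a : ℕ}
    (hidx : H.index < a !) (hN : a * a + 6 * a ≤ Fintype.card Ω) {ψ : Equiv.Perm Ω} (hψ : ψ ∈ H)
    (hlong : ∀ (x : Ω) (n : ℕ), 0 < n → (ψ ^ n) x = x → 3 * a ≤ n) : alternatingGroup Ω ≤ H := by
  obtain ⟨Δ, hΔ, hrel, hinv⟩ := exists_large_triRel_class H hidx hN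
  have huniv : ∀ x, x ∈ Δ := by
    by_contra! hc
    obtain ⟨x, hx⟩ := hc
    -- The exceptional set is invariant and has fewer than `3 * a` points, too few to contain a
    -- whole cycle of `ψ`.
    have hout : ∀ n : ℕ, (ψ ^ n) x ∈ Δᶜ := by
      intro n
      rw [Finset.mem_compl]
      intro hm
      have := hinv _ (H.inv_mem (H.pow_mem hψ n)) _ hm
      simp at this
      exact hx this
    have hinj : Set.InjOn (fun n : ℕ => (ψ ^ n) x) (Finset.range (3 * a)) := by
      have key : ∀ i j : ℕ, i < j → j < 3 * a → (ψ ^ i) x = (ψ ^ j) x → False := by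
        intro i j hij hj he
        have h1 : (ψ ^ (j - i)) x = x := by
          apply (ψ ^ i).injective
          rw [← Equiv.Perm.mul_apply, ← pow_add, he]
          congr 2; omega
        have := hlong x (j - i) (by omega) h1
        omega
      intro i hi j hj he
      simp only [Finset.coe_range, Set.mem_Iio] at hi hj
      rcases lt_trichotomy i j with h | h | h
      · exact (key i j h hj he).elim
      · exact h
      · exact (key j i h hi he.symm).elim
    have := Finset.card_le_card_of_injOn (s := Finset.range (3 * a)) (t := Δᶜ)
      (fun n : ℕ => (ψ ^ n) x) (fun n _ => hout n) hinj
    rw [Finset.card_range] at this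
    omega
  rw [← Equiv.Perm.closure_three_cycles_eq_alternating, Subgroup.closure_le]
  intro σ hσ
  obtain ⟨x, y, z, h1, h2, h3, -, -, -, rfl⟩ := IsThreeCycle.exists_eq_tricycle hσ
  exact TriRel.tricycle_mem h1 h2 h3 (hrel x (huniv x) y (huniv y)) (hrel x (huniv x) z (huniv z))

end Equiv.Perm

/-! ### Sums over orbits and permutations with long cycles. -/

/-- If a function is invariant under a permutation and all cycles on which it does not vanish
have length divisible by `q`, then `q` divides its sum. -/
theorem dvd_sum_of_perm_invariant {G : Type*} [Fintype G] (σ : Equiv.Perm G) (F : G → ℤ) {q : ℕ}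
    (hF : ∀ x, F (σ x) = F x)
    (hq : ∀ x, F x ≠ 0 → ∀ n : ℕ, (σ ^ n) x = x → q ∣ n) : (q : ℤ) ∣ ∑ x, F x := by
  rw [Finset.sum_partition (Equiv.Perm.SameCycle.setoid σ)]
  refine Finset.dvd_sum fun c hc => ?_
  obtain ⟨x, -, rfl⟩ := Finset.mem_image.1 hc
  have hconst : ∀ y, σ.SameCycle x y → F y = F x := by
    intro y hy
    obtain ⟨n, rfl⟩ := hy.exists_nat_pow_eq
    induction n with
    | zero => simp
    | succ n ih =>
      rw [pow_succ', Equiv.Perm.mul_apply, hF]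
      exact ih ⟨n, by simp⟩
  have hmem : ∀ y, (⟦y⟧ : Quotient (Equiv.Perm.SameCycle.setoid σ)) = ⟦x⟧ ↔ σ.SameCycle x y := by
    intro y
    rw [Quotient.eq]
    exact ⟨fun h => Equiv.Perm.SameCycle.symm h, fun h => Equiv.Perm.SameCycle.symm h⟩
  have hsum : (∑ y with (⟦y⟧ : Quotient (Equiv.Perm.SameCycle.setoid σ)) = ⟦x⟧, F y) =
      (Finset.univ.filter fun y => σ.SameCycle x y).card * F x := by
    rw [← nsmul_eq_mul, ← Finset.sum_const]
    refine Finset.sum_congr ?_ ?_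
    · ext y
      simp only [Finset.mem_filter, Finset.mem_univ, true_and, hmem]
    · intro y hy
      simp only [Finset.mem_filter, Finset.mem_univ, true_and] at hy
      exact hconst y hy
  change (q : ℤ) ∣ ∑ y with (⟦y⟧ : Quotient (Equiv.Perm.SameCycle.setoid σ)) = ⟦x⟧, F y
  rw [hsum]
  by_cases h0 : F x = 0
  · simp [h0]
  refine Dvd.dvd.mul_right ?_ _
  rw [Int.natCast_dvd_natCast]
  by_cases hx : σ x = x
  · have := hq x h0 1 (by simpa using hx)
    rw [Nat.dvd_one] at this
    simp [this]
  · have h1 : (Finset.univ.filter fun y => σ.SameCycle x y) = (σ.cycleOf x).support := by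
      ext y
      simp [Equiv.Perm.mem_support_cycleOf_iff' hx]
    rw [h1, ← (Equiv.Perm.isCycle_cycleOf σ hx).orderOf]
    refine hq x h0 _ ?_
    rw [← Equiv.Perm.cycleOf_pow_apply_self, pow_orderOf_eq_one]
    rfl

theorem pow_sub_dvd_of_pow_dvd_mul {p E α l n : ℕ} (hp : p.Prime) (h : p ^ E ∣ l * n)
    (hl : ¬ p ^ α ∣ l) : p ^ (E - α) ∣ n := by
  rcases Nat.eq_zero_or_pos n with rfl | hn
  · simp
  have hl0 : l ≠ 0 := by rintro rfl; simp at hl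
  rw [hp.pow_dvd_iff_le_factorization (by positivity), Nat.factorization_mul hl0 hn.ne'] at h
  rw [hp.pow_dvd_iff_le_factorization hl0] at hl
  rw [hp.pow_dvd_iff_le_factorization hn.ne']
  simp only [Finsupp.coe_add, Pi.add_apply] at h
  omega

/-- On a set whose cardinality is a multiple of `p ^ (E + 1)` there is an even permutation all
of whose cycle lengths are multiples of `p ^ E`. -/
theorem exists_alternating_long_cycles {Ω : Type*} [Fintype Ω] [DecidableEq Ω] {p E : ℕ}
    (hp : p.Prime) (h : p ^ (E + 1) ∣ Fintype.card Ω) :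
    ∃ τ ∈ alternatingGroup Ω, ∀ (x : Ω) (n : ℕ), (τ ^ n) x = x → p ^ E ∣ n := by
  obtain ⟨M, hM⟩ := h
  have hpos : 0 < p ^ (E + 1) := pow_pos hp.pos _
  have : NeZero (p ^ (E + 1)) := ⟨hpos.ne'⟩
  have e : Ω ≃ ZMod (p ^ (E + 1)) × Fin M := Fintype.equivOfCardEq (by
    rw [hM, Fintype.card_prod, ZMod.card, Fintype.card_fin])
  let τ₀ : Equiv.Perm Ω := e.trans (((Equiv.addRight 1).prodCongr (Equiv.refl _)).trans e.symm)
  have hstep : ∀ (n : ℕ) x, e ((τ₀ ^ n) x) = ((e x).1 + n, (e x).2) := by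
    intro n
    induction n with
    | zero => intro x; simp
    | succ n ih =>
      intro x
      rw [pow_succ' τ₀ n, Equiv.Perm.mul_apply]
      simp [τ₀, ih, add_assoc]
  -- Squaring the translation makes it even. For `p = 2` this halves the cycle lengths, which is why
  -- the hypothesis has exponent `E + 1`.
  refine ⟨τ₀ ^ 2, ?_, fun x n hx => ?_⟩
  · rw [Equiv.Perm.mem_alternatingGroup, map_pow]
    exact Int.units_sq _
  · rw [← pow_mul] at hx
    have h1 := hstep (2 * n) x
    rw [hx, Prod.ext_iff] at h1
    have h2 : ((2 * n : ℕ) : ZMod (p ^ (E + 1))) = 0 := by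
      have := h1.1
      simpa using this
    rw [ZMod.natCast_eq_zero_iff] at h2
    by_cases h2p : p = 2
    · subst h2p
      rw [pow_succ'] at h2
      exact Nat.dvd_of_mul_dvd_mul_left two_pos h2
    · have hc : Nat.Coprime (p ^ (E + 1)) 2 :=
        Nat.Coprime.pow_left _ ((Nat.coprime_primes hp Nat.prime_two).2 h2p)
      exact (pow_dvd_pow p (Nat.le_succ E)).trans (hc.dvd_of_dvd_mul_left h2)

/-! ### Circuit automorphisms and the stabilisers of gates. -/

namespace ModCircuit

variable {m : ℕ} {X : Type}

theorem Extends.mul {C : ModCircuit m X} {π π' : Equiv.Perm X} {σ σ' : Equiv.Perm C.Gate}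
    (h : C.Extends π σ) (h' : C.Extends π' σ') : C.Extends (π * π') (σ * σ') := by
  refine ⟨fun g => ?_, fun g g' => ?_⟩
  · rw [Equiv.Perm.mul_apply, h.1, h'.1]
    cases C.label g <;> simp
  · rw [Equiv.Perm.mul_apply, Equiv.Perm.mul_apply, h.2, h'.2]

theorem Extends.one (C : ModCircuit m X) : C.Extends 1 1 :=
  ⟨fun g => by cases h : C.label g <;> simp [h], fun _ _ => rfl⟩

theorem Extends.inv {C : ModCircuit m X} {π : Equiv.Perm X} {σ : Equiv.Perm C.Gate}
    (h : C.Extends π σ) : C.Extends π⁻¹ σ⁻¹ := by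
  refine ⟨fun g => ?_, fun g g' => ?_⟩
  · have := h.1 (σ⁻¹ g)
    rw [show σ (σ⁻¹ g) = g by simp] at this
    rw [this]
    cases C.label (σ⁻¹ g) <;> simp
  · rw [← h.2]
    simp

theorem Extends.pow {C : ModCircuit m X} {π : Equiv.Perm X} {σ : Equiv.Perm C.Gate}
    (h : C.Extends π σ) (n : ℕ) : C.Extends (π ^ n) (σ ^ n) := by
  induction n with
  | zero => exact Extends.one C
  | succ n ih => rw [pow_succ, pow_succ]; exact ih.mul h

theorem Extends.eval_apply {C : ModCircuit m X} {π : Equiv.Perm X} {σ : Equiv.Perm C.Gate}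
    (h : C.Extends π σ) (a : X → Bool) (ha : ∀ x, a (π x) = a x) (g : C.Gate) :
    C.eval a (σ g) = C.eval a g := by
  induction g using C.acyclic.induction with
  | _ g ih =>
  have hl := h.1 g
  rcases hg : C.label g with x | R
  · rw [hg] at hl
    rw [C.eval_input a hg, C.eval_input a (x := π x) (by rw [hl]; rfl), ha]
  · rw [hg] at hl
    have hs : (∑ g', C.wires g' (σ g) * (C.eval a g').toNat) =
        ∑ g', C.wires g' g * (C.eval a g').toNat := by
      rw [← Equiv.sum_comp σ]
      refine Finset.sum_congr rfl fun g' _ => ?_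
      rw [h.2]
      rcases Nat.eq_zero_or_pos (C.wires g' g) with h0 | h0
      · rw [h0]; simp
      · rw [ih g' h0]
    rw [Bool.eq_iff_iff, C.eval_mod a (R := R) (by rw [hl]; rfl), C.eval_mod a hg, hs]

/-- The permutations `π` for which some automorphism of the circuit that extends `ρ π` fixes the
gate `g`. -/
def fixer (C : ModCircuit m X) {P : Type*} [Group P] (ρ : P →* Equiv.Perm X) (g : C.Gate) :
    Subgroup P where
  carrier := {π | ∃ σ, C.Extends (ρ π) σ ∧ σ g = g}
  mul_mem' := by
    rintro a b ⟨σ, h1, h2⟩ ⟨σ', h1', h2'⟩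
    exact ⟨σ * σ', by rw [map_mul]; exact h1.mul h1', by rw [Equiv.Perm.mul_apply, h2', h2]⟩
  one_mem' := ⟨1, by rw [map_one]; exact Extends.one C, rfl⟩
  inv_mem' := by
    rintro a ⟨σ, h1, h2⟩
    exact ⟨σ⁻¹, by rw [map_inv]; exact h1.inv, by rw [Equiv.Perm.inv_eq_iff_eq, h2]⟩

/-- An orbit-stabiliser argument without a group action on the gates: extensions need not be unique,
so one is chosen for a representative of each coset. Representatives sending `g` to the same gate
lie in the same coset. -/
theorem index_fixer_le (C : ModCircuit m X) {P : Type*} [Group P] (ρ : P →* Equiv.Perm X)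
    (hsym : ∀ π, ∃ σ, C.Extends (ρ π) σ) (g : C.Gate) :
    (C.fixer ρ g).index ≤ Fintype.card C.Gate := by
  choose f hf using hsym
  rw [Subgroup.index, ← Nat.card_eq_fintype_card]
  refine Nat.card_le_card_of_injective (fun q : P ⧸ C.fixer ρ g => f q.out g) fun q q' h => ?_
  rw [← QuotientGroup.out_eq' q, ← QuotientGroup.out_eq' q', QuotientGroup.eq]
  refine ⟨(f q.out)⁻¹ * f q'.out, ?_, ?_⟩
  · rw [map_mul, map_inv]
    exact (hf _).inv.mul (hf _)
  · rw [Equiv.Perm.mul_apply, Equiv.Perm.inv_eq_iff_eq]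
    exact h.symm

open scoped Nat in
/-- In a small symmetric circuit, a gate that is fixed by the alternating group of a suitable set
of points cannot tell apart two invariant assignments. -/
theorem eval_eq_of_alternatingGroup_le (C : ModCircuit m X)
    {Ω : Type*} [Fintype Ω] [DecidableEq Ω] (ρ : Equiv.Perm Ω →* Equiv.Perm X)
    (hsym : ∀ π, ∃ σ, C.Extends (ρ π) σ) {b₀ b₁ : X → Bool}
    (hb₀ : ∀ π x, b₀ (ρ π x) = b₀ x) (hb₁ : ∀ π x, b₁ (ρ π x) = b₁ x)
    (hin : ∀ x, (∀ π ∈ alternatingGroup Ω, ρ π x = x) → b₀ x = b₁ x) {a : ℕ}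
    (hcard : Fintype.card C.Gate < a !) (hN : a * a + 6 * a ≤ Fintype.card Ω)
    (hlong : ∀ p α, p.Prime → α ≠ 0 → p ^ α ∣ m → ∃ E, 3 * a * p ^ α ≤ p ^ E ∧
      p ^ (E + 1) ∣ Fintype.card Ω) (g : C.Gate)
    (hg : alternatingGroup Ω ≤ C.fixer ρ g) : C.eval b₀ g = C.eval b₁ g := by
  induction g using C.acyclic.induction with
  | _ g ih =>
  rcases hl : C.label g with x | R
  · rw [C.eval_input b₀ hl, C.eval_input b₁ hl]
    refine hin x fun π hπ => ?_
    obtain ⟨σ, hσ, hσg⟩ := hg hπ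
    have := hσ.1 g
    rw [hσg, hl] at this
    simpa using this.symm
  -- The sum is the difference of the two input sums of `g`; its divisibility by `m` is tested on
  -- the prime powers dividing `m`.
  · have hmod : ((m : ℕ) : ℤ) ∣
        ∑ g', (C.wires g' g : ℤ) * (((C.eval b₀ g').toNat : ℤ) - (C.eval b₁ g').toNat) := by
      rw [Int.natCast_dvd, Nat.dvd_iff_prime_pow_dvd_dvd]
      intro p α hp hα
      rw [← Int.natCast_dvd]
      by_cases hα0 : α = 0
      · simp [hα0]
      obtain ⟨E, hE, hEd⟩ := hlong p α hp hα0 hα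
      obtain ⟨τ, hτ, hτc⟩ := exists_alternating_long_cycles hp hEd
      obtain ⟨σ, hσ, hσg⟩ := hg hτ
      refine dvd_sum_of_perm_invariant σ _ (fun g' => ?_) fun g' hne n hn => ?_
      · rw [hσ.eval_apply b₀ (hb₀ τ), hσ.eval_apply b₁ (hb₁ τ)]
        nth_rw 1 [← hσg]
        rw [hσ.2]
      -- If `σ ^ n` fixes `g'` and `p ^ α ∤ n`, then `τ ^ n` stabilises `g'`, and its cycles still
      -- have length at least `p ^ (E - α) ≥ 3 * a`. So the alternating group fixes `g'`, and by
      -- induction the summand at `g'` is zero.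
      · by_contra hpn
        have hw : 0 < C.wires g' g := by
          rcases Nat.eq_zero_or_pos (C.wires g' g) with h | h
          · rw [h] at hne; simp at hne
          · exact h
        have hfix : τ ^ n ∈ C.fixer ρ g' := ⟨σ ^ n, by rw [map_pow]; exact hσ.pow n, hn⟩
        have halt := Equiv.Perm.alternatingGroup_le_of_long_cycles (C.fixer ρ g')
          ((C.index_fixer_le ρ hsym g').trans_lt hcard) hN hfix (fun x j hj hx => by
            rw [← pow_mul] at hx
            have h1 := pow_sub_dvd_of_pow_dvd_mul hp (hτc x _ hx) hpn
            have h2 := Nat.le_of_dvd hj h1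
            have hαE : α ≤ E := by
              have ha : 0 < a := by
                rcases Nat.eq_zero_or_pos a with rfl | h
                · have : 0 < Fintype.card C.Gate := Fintype.card_pos_iff.2 ⟨g⟩
                  simp at hcard; omega
                · exact h
              have : p ^ α ≤ p ^ E := le_trans (Nat.le_mul_of_pos_left _ (by omega)) hE
              exact (Nat.pow_le_pow_iff_right hp.one_lt).1 this
            have h3 : 3 * a * p ^ α ≤ p ^ (E - α) * p ^ α := by
              rwa [← pow_add, Nat.sub_add_cancel hαE]
            exact (Nat.le_of_mul_le_mul_right h3 (pow_pos hp.pos _)).trans h2)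
        rw [ih g' hw halt] at hne
        simp at hne
    have hcast : ((∑ g', C.wires g' g * (C.eval b₀ g').toNat : ℕ) : ZMod m) =
        ((∑ g', C.wires g' g * (C.eval b₁ g').toNat : ℕ) : ZMod m) := by
      have := (ZMod.intCast_zmod_eq_zero_iff_dvd _ m).2 hmod
      push_cast at this ⊢
      rw [← sub_eq_zero, ← Finset.sum_sub_distrib, ← this]
      exact Finset.sum_congr rfl fun g' _ => by ring
    rw [Bool.eq_iff_iff, C.eval_mod b₀ hl, C.eval_mod b₁ hl, hcast]

end ModCircuit

/-! ### Coordinate permutations as tree automorphisms. -/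

namespace BlockTree

variable {h : ℕ} {k : Fin h → ℕ}

/-- Permutations of the factors act on the leaves coordinatewise. -/
def leafPerm (k : Fin h → ℕ) : (∀ i, Equiv.Perm (Fin (k i))) →* Equiv.Perm (Leaf k) where
  toFun σ := Equiv.piCongrRight σ
  map_one' := rfl
  map_mul' _ _ := rfl

theorem leafPerm_apply (σ : ∀ i, Equiv.Perm (Fin (k i))) (x : Leaf k) (i : Fin h) :
    leafPerm k σ x i = σ i (x i) := rfl

theorem leafPerm_mem_autLeaf (σ : ∀ i, Equiv.Perm (Fin (k i))) : leafPerm k σ ∈ autLeaf k := by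
  refine ⟨⟨Equiv.sigmaCongrRight fun i => Equiv.piCongrRight fun j => σ j.1, ?_⟩, fun x => rfl⟩
  rintro ⟨i, u⟩ ⟨i', v⟩
  change _ ∧ (∀ (j : Fin h) (hu : (i : ℕ) ≤ j) (hv : (i' : ℕ) ≤ j),
    σ j (u ⟨j, hu⟩) = σ j (v ⟨j, hv⟩)) ↔ _
  simp only [EmbeddingLike.apply_eq_iff_eq]
  exact Iff.rfl

/-- Permutations of one factor act on the leaves. -/
def coordPerm (k : Fin h → ℕ) (j : Fin h) : Equiv.Perm (Fin (k j)) →* Equiv.Perm (Leaf k) :=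
  (leafPerm k).comp (MonoidHom.mulSingle (fun i => Equiv.Perm (Fin (k i))) j)

theorem coordPerm_apply_same (j : Fin h) (σ : Equiv.Perm (Fin (k j))) (x : Leaf k) :
    coordPerm k j σ x j = σ (x j) := by
  simp [coordPerm, leafPerm_apply]

theorem coordPerm_mem_autLeaf (j : Fin h) (σ : Equiv.Perm (Fin (k j))) :
    coordPerm k j σ ∈ autLeaf k := leafPerm_mem_autLeaf _

end BlockTree

/-! ### The factorial lower bound on the number of gates. -/

theorem exists_eq_maxBlock {h : ℕ} (hh : 1 ≤ h) (k : Fin h → ℕ) : ∃ j, k j = maxBlock k := by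
  obtain ⟨j, -, hj⟩ := Finset.exists_mem_eq_sup Finset.univ ⟨⟨0, hh⟩, Finset.mem_univ _⟩ k
  exact ⟨j, hj.symm⟩

/-- A number divisible by high powers of all primes of `m`, of controlled size. -/
theorem exists_prime_power_period {m : ℕ} (hm : m ≠ 0) {a : ℕ} (ha : 0 < a) :
    ∃ M, (4 * a) ^ m.primeFactors.card ≤ M ∧ M ≤ (4 * a) ^ m.primeFactors.card * m ^ 3 ∧
      ∀ p α, p.Prime → α ≠ 0 → p ^ α ∣ m → ∃ E, 3 * a * p ^ α ≤ p ^ E ∧ p ^ (E + 1) ∣ M := by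
  have key : ∀ p ∈ m.primeFactors, ∃ E, 4 * a * p ^ m.factorization p ≤ p ^ E ∧
      p ^ E ≤ 4 * a * p ^ m.factorization p * p := by
    intro p hp
    have hp1 := (Nat.prime_of_mem_primeFactors hp).one_lt
    have hex : ∃ E, 4 * a * p ^ m.factorization p ≤ p ^ E :=
      ⟨_, (Nat.lt_pow_self hp1).le⟩
    refine ⟨Nat.find hex, Nat.find_spec hex, ?_⟩
    rcases hE : Nat.find hex with _ | E
    · have : 0 < p ^ m.factorization p := by positivity
      have : 0 < 4 * a * p ^ m.factorization p * p := by positivity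
      rw [pow_zero]
      exact this
    · have := Nat.find_min hex (m := E) (by omega)
      rw [pow_succ]
      exact Nat.mul_le_mul_right _ (by omega)
  choose! E hE1 hE2 using key
  have hpos : ∀ p ∈ m.primeFactors, 0 < p := fun p hp => (Nat.prime_of_mem_primeFactors hp).pos
  -- The additional factor `p` pays for the passage to an even permutation.
  refine ⟨∏ p ∈ m.primeFactors, p ^ (E p + 1), ?_, ?_, ?_⟩
  · rw [← Finset.prod_const]
    refine Finset.prod_le_prod' fun p hp => ?_
    have h1 : 0 < p ^ m.factorization p := pow_pos (hpos p hp) _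
    calc 4 * a ≤ 4 * a * p ^ m.factorization p := Nat.le_mul_of_pos_right _ h1
      _ ≤ p ^ E p := hE1 p hp
      _ ≤ p ^ (E p + 1) := Nat.pow_le_pow_right (hpos p hp) (Nat.le_succ _)
  · have hrad : ∏ p ∈ m.primeFactors, p ≤ m :=
      Nat.le_of_dvd (Nat.pos_of_ne_zero hm) (Nat.prod_primeFactors_dvd m)
    have hfac : ∏ p ∈ m.primeFactors, p ^ m.factorization p = m := by
      have := Nat.prod_factorization_pow_eq_self hm
      rwa [Finsupp.prod, Nat.support_factorization] at this
    calc ∏ p ∈ m.primeFactors, p ^ (E p + 1)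
        ≤ ∏ p ∈ m.primeFactors, (4 * a * p ^ m.factorization p * p * p) := by
          refine Finset.prod_le_prod' fun p hp => ?_
          rw [pow_succ]
          exact Nat.mul_le_mul_right _ (hE2 p hp)
      _ = (4 * a) ^ m.primeFactors.card * m * (∏ p ∈ m.primeFactors, p) *
            (∏ p ∈ m.primeFactors, p) := by
          rw [Finset.prod_mul_distrib, Finset.prod_mul_distrib, Finset.prod_mul_distrib,
            Finset.prod_const, hfac]
      _ ≤ (4 * a) ^ m.primeFactors.card * m * m * m := by gcongr
      _ = _ := by ring
  · intro p α hp hα hd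
    have hpm : p ∈ m.primeFactors :=
      Nat.mem_primeFactors.2 ⟨hp, (dvd_pow_self p hα).trans hd, hm⟩
    refine ⟨E p, ?_, Finset.dvd_prod_of_mem (fun p => p ^ (E p + 1)) hpm⟩
    have h1 : α ≤ m.factorization p := (hp.pow_dvd_iff_le_factorization hm).1 hd
    calc 3 * a * p ^ α ≤ 4 * a * p ^ m.factorization p := by
          have := Nat.pow_le_pow_right hp.pos h1
          gcongr
          norm_num
      _ ≤ _ := hE1 p hpm

theorem Equiv.Perm.ofSubtype_tricycle {Ω : Type*} [DecidableEq Ω] {B : Finset Ω} (x y z : B) :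
    Equiv.Perm.ofSubtype (Equiv.Perm.tricycle x y z) = Equiv.Perm.tricycle (x : Ω) y z := by
  simp only [Equiv.Perm.tricycle, map_mul, Equiv.Perm.ofSubtype_swap_eq]

open scoped Nat in
/-- A symmetric circuit for the conjunction has at least `a!` gates, as soon as the largest
block has size at least a constant times `a ^ r`. -/
theorem factorial_le_card_gate {m h : ℕ} (hr : 2 ≤ m.primeFactors.card) (hh : 1 ≤ h)
    {k : Fin h → ℕ} (hk : ∀ i, 0 < k i) {a : ℕ} (ha : 0 < a)
    (hak : (4 * a) ^ m.primeFactors.card * (m ^ 3 + 1) ≤ maxBlock k)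
    (D : ModCircuit m (BlockTree.Leaf k)) (hD : IsBlockSymmetricAnd D) :
    a ! ≤ Fintype.card D.Gate := by
  by_contra! hcard
  have hm : m ≠ 0 := by rintro rfl; simp at hr
  obtain ⟨j, hj⟩ := exists_eq_maxBlock hh k
  rw [← hj] at hak
  have hsq : 16 * (a * a) ≤ (4 * a) ^ m.primeFactors.card :=
    calc 16 * (a * a) = (4 * a) ^ 2 := by ring
      _ ≤ _ := Nat.pow_le_pow_right (by omega) hr
  have haa : a ≤ a * a := Nat.le_mul_of_pos_left a ha
  have hsymm : ∀ π, ∃ σ, D.Extends (BlockTree.coordPerm k j π) σ := fun π =>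
    hD.1 _ (BlockTree.coordPerm_mem_autLeaf j π)
  have hle : (4 * a) ^ m.primeFactors.card ≤ (4 * a) ^ m.primeFactors.card * (m ^ 3 + 1) :=
    Nat.le_mul_of_pos_right _ (by positivity)
  obtain ⟨Δ, hΔ, hrel, -⟩ := Equiv.Perm.exists_large_triRel_class
    (D.fixer (BlockTree.coordPerm k j) D.root)
    ((D.index_fixer_le _ hsymm D.root).trans_lt hcard) (by rw [Fintype.card_fin]; omega)
  obtain ⟨M, hM1, hM2, hM3⟩ := exists_prime_power_period hm ha
  -- The `1` in `m ^ 3 + 1` reserves at least `16 * (a * a)` points, more than the `3 * a` that `Δ`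
  -- may miss.
  have hMΔ : M ≤ Δ.card := by
    have := Finset.card_add_card_compl Δ
    rw [Fintype.card_fin] at this
    rw [mul_add, mul_one] at hak
    omega
  obtain ⟨B, hBΔ, hBM⟩ := Finset.exists_subset_card_eq hMΔ
  have hBcard : Fintype.card B = M := by rw [Fintype.card_coe, hBM]
  let ρ : Equiv.Perm B →* Equiv.Perm (BlockTree.Leaf k) :=
    (BlockTree.coordPerm k j).comp Equiv.Perm.ofSubtype
  have hρ : ∀ π x, ρ π x j = Equiv.Perm.ofSubtype π (x j) := fun π x =>
    BlockTree.coordPerm_apply_same j _ x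
  have hmemB : ∀ (π : Equiv.Perm B) (w : Fin (k j)), Equiv.Perm.ofSubtype π w ∈ B ↔ w ∈ B := by
    intro π w
    exact Equiv.Perm.ofSubtype_apply_mem_iff_mem π w
  have hroot : alternatingGroup B ≤ D.fixer ρ D.root := by
    rw [← Equiv.Perm.closure_three_cycles_eq_alternating, Subgroup.closure_le]
    intro σ hσ
    obtain ⟨x, y, z, h1, h2, h3, -, -, -, rfl⟩ := Equiv.Perm.IsThreeCycle.exists_eq_tricycle hσ
    change Equiv.Perm.ofSubtype (Equiv.Perm.tricycle x y z) ∈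
      D.fixer (BlockTree.coordPerm k j) D.root
    rw [Equiv.Perm.ofSubtype_tricycle]
    exact Equiv.Perm.TriRel.tricycle_mem (Subtype.coe_injective.ne h1)
      (Subtype.coe_injective.ne h2) (Subtype.coe_injective.ne h3)
      (hrel _ (hBΔ x.2) _ (hBΔ y.2)) (hrel _ (hBΔ x.2) _ (hBΔ z.2))
  -- The assignments differ only at leaves with `j`-th coordinate in `B`. No such leaf is fixed by
  -- the alternating group, because `B` has at least three points and a 3-cycle moves that
  -- coordinate.
  have hevals := D.eval_eq_of_alternatingGroup_le ρ (fun π => hsymm _)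
    (b₀ := fun x => decide (x j ∉ B)) (b₁ := fun _ => true)
    (fun π x => by
      rw [hρ]
      simp only [hmemB])
    (fun _ _ => rfl)
    (fun x hx => by
      simp only [decide_eq_true_eq]
      intro hxB
      have h3 : 3 ≤ B.card := by omega
      obtain ⟨y, hy, hyx⟩ : ∃ y ∈ B, y ≠ x j := Finset.exists_mem_ne (by omega) _
      obtain ⟨z, hz⟩ : (B \ {x j, y}).Nonempty := by
        rw [← Finset.card_pos]
        have h4 := Finset.le_card_sdiff {x j, y} B
        have h5 : ({x j, y} : Finset (Fin (k j))).card ≤ 2 := Finset.card_le_two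
        omega
      simp only [Finset.mem_sdiff, Finset.mem_insert, Finset.mem_singleton, not_or] at hz
      have ht : Equiv.Perm.tricycle (⟨x j, hxB⟩ : B) ⟨y, hy⟩ ⟨z, hz.1⟩ ∈ alternatingGroup B := by
        rw [Equiv.Perm.mem_alternatingGroup, Equiv.Perm.tricycle, map_mul,
          Equiv.Perm.sign_swap, Equiv.Perm.sign_swap]
        · simp
        · simpa [Subtype.ext_iff] using Ne.symm hyx
        · simpa [Subtype.ext_iff] using Ne.symm hz.2.1
      have := congrFun (hx _ ht) j
      rw [hρ, Equiv.Perm.ofSubtype_tricycle, Equiv.Perm.tricycle_fst (Ne.symm hyx)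
        (Ne.symm hz.2.2)] at this
      exact hyx this)
    hcard (by omega) (fun p α hp hα hd => by rw [hBcard]; exact hM3 p α hp hα hd) D.root hroot
  have htrue : D.eval (fun _ => true) D.root = true := (hD.2 _).2 fun _ => rfl
  rw [htrue, hD.2] at hevals
  obtain ⟨b, hb⟩ : B.Nonempty := by rw [← Finset.card_pos]; omega
  have := hevals (Function.update (fun i => ⟨0, hk i⟩) j b)
  simp [hb] at this

/-! ### Divisibility of the number of zeros as a modular sum of disjunctions -/

/-- The truncated alternating sum `∑ j ≤ d, (-1) ^ (d - j) * z.choose j`. -/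
def altChoose (R : Type*) [Ring R] (d z : ℕ) : R :=
  ∑ j ∈ Finset.range (z + 1), z.choose j • (if j ≤ d then (-1 : R) ^ (d - j) else 0)

/-- Summing up to `z` fits sums over subsets; summing up to `d` has a range independent of `z`, as
needed for periodicity. -/
theorem altChoose_eq_sum_range (R : Type*) [Ring R] (d z : ℕ) :
    altChoose R d z = ∑ j ∈ Finset.range (d + 1), (-1 : R) ^ (d - j) * z.choose j := by
  have h1 : altChoose R d z = ∑ j ∈ Finset.range (z + d + 1),
      z.choose j • (if j ≤ d then (-1 : R) ^ (d - j) else 0) := by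
    refine Finset.sum_subset (Finset.range_mono (by omega)) fun j _ hj => ?_
    rw [Nat.choose_eq_zero_of_lt (by simpa using hj), zero_smul]
  rw [h1]
  symm
  refine Finset.sum_subset_zero_on_sdiff (Finset.range_mono (by omega)) (fun j hj => ?_)
    fun j hj => ?_
  · simp only [Finset.mem_sdiff, Finset.mem_range] at hj
    rw [if_neg (by omega), smul_zero]
  · rw [if_pos (by simpa [Nat.lt_succ_iff] using hj), nsmul_eq_mul]
    exact (Nat.cast_commute _ _).eq.symm

/-- In Vandermonde's identity every other term contains `(p ^ e).choose i` with `0 < i < p ^ e`, a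
multiple of `p`. -/
theorem choose_add_prime_pow {p e : ℕ} (hp : p.Prime) (z : ℕ) {j : ℕ} (hj : j < p ^ e) :
    (((z + p ^ e).choose j : ℕ) : ZMod p) = (z.choose j : ℕ) := by
  rw [add_comm z, Nat.add_choose_eq, Nat.cast_sum,
    Finset.sum_eq_single_of_mem (0, j) (by simp)]
  · simp
  · rintro ⟨i, l⟩ hil hne
    rw [Finset.HasAntidiagonal.mem_antidiagonal] at hil
    have hi : i ≠ 0 := by
      rintro rfl
      simp only [zero_add] at hil
      exact hne (by rw [hil])
    have h := hp.dvd_choose_pow hi (by simp only at hil; omega : i ≠ p ^ e)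
    rw [ZMod.natCast_eq_zero_iff]
    exact h.mul_right _

/-- Both sides have period `p ^ e` in `z`. For `0 < z < p ^ e` the truncation is void and the sum is
`± (1 - 1) ^ z = 0`; at `z = 0` only the term `(-1) ^ (p ^ e - 1)` remains, which is 1 modulo `p`.
-/
theorem altChoose_prime_pow {p : ℕ} (hp : p.Prime) (e z : ℕ) :
    altChoose (ZMod p) (p ^ e - 1) z = if p ^ e ∣ z then 1 else 0 := by
  have hpos : 0 < p ^ e := pow_pos hp.pos e
  induction z using Nat.strong_induction_on with
  | _ z ih =>
  rcases Nat.lt_or_ge z (p ^ e) with hz | hz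
  · rcases Nat.eq_zero_or_pos z with rfl | hz0
    · have : (-1 : ZMod p) ^ (p ^ e - 1) = 1 := by
        rcases hp.eq_two_or_odd' with rfl | hodd
        · have : (-1 : ZMod 2) = 1 := by decide
          rw [this, one_pow]
        · exact Even.neg_one_pow (Nat.Odd.sub_odd (hodd.pow) odd_one)
      simp [altChoose, this]
    · rw [if_neg (fun hd => by have := Nat.le_of_dvd hz0 hd; omega)]
      have h1 : altChoose (ZMod p) (p ^ e - 1) z =
          (-1) ^ (p ^ e - 1) * ((-1 : ZMod p) + 1) ^ z := by
        rw [add_pow, Finset.mul_sum]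
        refine Finset.sum_congr rfl fun j hj => ?_
        have hj' : j ≤ p ^ e - 1 := by
          have := Finset.mem_range.1 hj
          omega
        have h2 : (-1 : ZMod p) ^ (p ^ e - 1) = (-1) ^ (p ^ e - 1 - j) * (-1) ^ j := by
          rw [← pow_add, Nat.sub_add_cancel hj']
        have h3 : (-1 : ZMod p) ^ j * (-1) ^ j = 1 := by
          rw [← mul_pow]; simp
        rw [if_pos hj', h2, nsmul_eq_mul, one_pow, mul_one]
        linear_combination (-(z.choose j : ZMod p) * (-1) ^ (p ^ e - 1 - j)) * h3
      rw [h1, neg_add_cancel, zero_pow hz0.ne', mul_zero]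
  · obtain ⟨y, rfl⟩ := Nat.exists_eq_add_of_le' hz
    have h1 : altChoose (ZMod p) (p ^ e - 1) (y + p ^ e) =
        altChoose (ZMod p) (p ^ e - 1) y := by
      rw [altChoose_eq_sum_range, altChoose_eq_sum_range]
      refine Finset.sum_congr rfl fun j hj => ?_
      rw [choose_add_prime_pow hp y (by have := Finset.mem_range.1 hj; omega)]
    rw [h1, ih y (by omega)]
    simp

section OrSum

variable {N : Type*} [Fintype N]

theorem card_functions_supported (q : ℕ) [NeZero q] (S : Finset N) :
    (Finset.univ.filter fun a : N → ZMod q => ∀ u, u ∉ S → a u = 0).card = q ^ S.card := by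
  have : (Finset.univ.filter fun a : N → ZMod q => ∀ u, u ∉ S → a u = 0) =
      Fintype.piFinset fun u => if u ∈ S then Finset.univ else {0} := by
    ext a
    simp only [Finset.mem_filter, Finset.mem_univ, true_and, Fintype.mem_piFinset]
    refine forall_congr' fun u => ?_
    by_cases hu : u ∈ S <;> simp [hu]
  rw [this, Fintype.card_piFinset]
  simp only [apply_ite Finset.card, Finset.card_univ, ZMod.card, Finset.card_singleton]
  rw [Finset.prod_ite]
  simp

/-- The number of linear forms on `S` that take the value `1` at a given Boolean vector. -/
theorem card_forms_eq_one {q : ℕ} [NeZero q] (hq : q.Prime) (S : Finset N) (x : N → Bool) :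
    (Finset.univ.filter fun a : N → ZMod q =>
      (∀ u, u ∉ S → a u = 0) ∧ ∑ u, a u * (x u).toNat = 1).card =
      if ∃ u ∈ S, x u = true then q ^ (S.card - 1) else 0 := by
  have : Fact q.Prime := ⟨hq⟩
  split_ifs with hx
  · obtain ⟨u₀, hu₀, hx₀⟩ := hx
    let F : ZMod q → Finset (N → ZMod q) := fun c => Finset.univ.filter fun a =>
      (∀ u, u ∉ S → a u = 0) ∧ ∑ u, a u * (x u).toNat = c
    have hsum : ∀ (a : N → ZMod q) c,
        ∑ u, (a + Pi.single u₀ c : N → ZMod q) u * ((x u).toNat : ZMod q) =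
          (∑ u, a u * ((x u).toNat : ZMod q)) + c := by
      intro a c
      simp only [Pi.add_apply, add_mul, Finset.sum_add_distrib]
      congr 1
      rw [Finset.sum_eq_single u₀]
      · simp [hx₀]
      · intro u _ hu
        simp [Pi.single_eq_of_ne hu]
      · simp
    -- Shifting the coefficient of the true variable `u₀` is a bijection between forms of different
    -- values, so all `q` values are equally frequent.
    have hF : ∀ c, (F c).card = (F 1).card := by
      intro c
      refine Finset.card_bij' (fun a _ => a + Pi.single u₀ (1 - c))
        (fun a _ => a + Pi.single u₀ (c - 1)) ?_ ?_ ?_ ?_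
      · intro a ha
        simp only [F, Finset.mem_filter, Finset.mem_univ, true_and] at ha ⊢
        refine ⟨fun u hu => ?_, by rw [hsum, ha.2]; ring⟩
        have : u ≠ u₀ := fun h => hu (h ▸ hu₀)
        simp [Pi.single_eq_of_ne this, ha.1 u hu]
      · intro a ha
        simp only [F, Finset.mem_filter, Finset.mem_univ, true_and] at ha ⊢
        refine ⟨fun u hu => ?_, by rw [hsum, ha.2]; ring⟩
        have : u ≠ u₀ := fun h => hu (h ▸ hu₀)
        simp [Pi.single_eq_of_ne this, ha.1 u hu]
      · intro a _
        rw [add_assoc, ← Pi.single_add]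
        simp
      · intro a _
        rw [add_assoc, ← Pi.single_add]
        simp
    have htot := card_functions_supported q S
    rw [Finset.card_eq_sum_card_fiberwise (t := Finset.univ)
      (f := fun a : N → ZMod q => ∑ u, a u * ((x u).toNat : ZMod q)) (by simp)] at htot
    have h2 : ∀ c : ZMod q, ((Finset.univ.filter fun a : N → ZMod q => ∀ u, u ∉ S → a u = 0).filter
        fun a => ∑ u, a u * ((x u).toNat : ZMod q) = c).card = (F 1).card := by
      intro c
      rw [← hF c, Finset.filter_filter]
    simp only [h2, Finset.sum_const, Finset.card_univ, ZMod.card, smul_eq_mul] at htot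
    have hS : 0 < S.card := Finset.card_pos.2 ⟨u₀, hu₀⟩
    have h3 : q * (F 1).card = q * q ^ (S.card - 1) := by
      rw [htot, ← pow_succ', Nat.sub_add_cancel hS]
    exact Nat.eq_of_mul_eq_mul_left hq.pos h3
  · rw [Finset.card_eq_zero, Finset.filter_eq_empty_iff]
    rintro a - ⟨h1, h2⟩
    push Not at hx
    refine one_ne_zero (α := ZMod q) (h2.symm.trans (Finset.sum_eq_zero fun u _ => ?_))
    by_cases hu : u ∈ S
    · have := hx u hu
      simp [this]
    · simp [h1 u hu]

/-- The disjunction over `S` fails exactly when `S` consists of zeros of `x`, so the terms missing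
from the full sum are those of the subsets of the zero set. -/
theorem sum_powerset_or (R : Type*) [Ring R] (d : ℕ) (ch : Finset N) (x : N → Bool) :
    ∑ S ∈ ch.powerset, (if S.card ≤ d then (-1 : R) ^ (d - S.card) else 0) *
        (if ∃ u ∈ S, x u = true then 1 else 0) =
      altChoose R d ch.card - altChoose R d (ch.filter fun u => x u = false).card := by
  have h1 := Finset.sum_powerset_apply_card (x := ch)
    (fun j => if j ≤ d then (-1 : R) ^ (d - j) else 0)
  have h2 := Finset.sum_powerset_apply_card (x := ch.filter fun u => x u = false)
    (fun j => if j ≤ d then (-1 : R) ^ (d - j) else 0)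
  rw [altChoose, altChoose, ← h1, ← h2]
  have h3 : (ch.filter fun u => x u = false).powerset =
      ch.powerset.filter fun S => ¬ ∃ u ∈ S, x u = true := by
    ext S
    simp only [Finset.mem_powerset, Finset.mem_filter, Finset.subset_iff, not_exists, not_and,
      Bool.not_eq_true]
    grind
  rw [h3, Finset.sum_filter, ← Finset.sum_sub_distrib]
  refine Finset.sum_congr rfl fun S _ => ?_
  by_cases h : ∃ u ∈ S, x u = true
  · rw [if_pos h, if_neg (not_not.2 h)]; simp
  · rw [if_neg h, if_pos h]; simp

/-- The coefficient with which the linear forms on a set of size `j` enter. -/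
def formCoeff (p q d j : ℕ) : ZMod p := (-1) ^ (d - j) * ((q : ZMod p) ^ (j - 1))⁻¹

/-- Modulo `p`, the indicator of `p ^ e ∣ #zeros` is an affine combination of tests modulo `q`
of linear forms in fewer than `p ^ e` variables. -/
theorem sum_formCoeff {p q : ℕ} (hp : p.Prime) (hq : q.Prime) (hpq : q ≠ p) [NeZero q] (e : ℕ)
    (ch : Finset N) (x : N → Bool) :
    (∑ S : Finset N, ∑ a : N → ZMod q,
      if S.card ≤ p ^ e - 1 ∧ S ⊆ ch ∧ (∀ u, u ∉ S → a u = 0) ∧ ∑ u, a u * (x u).toNat = 1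
      then formCoeff p q (p ^ e - 1) S.card else 0) =
      altChoose (ZMod p) (p ^ e - 1) ch.card -
        if p ^ e ∣ (ch.filter fun u => x u = false).card then 1 else 0 := by
  have : Fact p.Prime := ⟨hp⟩
  rw [← altChoose_prime_pow hp, ← sum_powerset_or]
  have hsub : ∀ S : Finset N, (∑ a : N → ZMod q,
      if S.card ≤ p ^ e - 1 ∧ S ⊆ ch ∧ (∀ u, u ∉ S → a u = 0) ∧ ∑ u, a u * (x u).toNat = 1
      then formCoeff p q (p ^ e - 1) S.card else 0) =
      if S ⊆ ch then (if S.card ≤ p ^ e - 1 then (-1 : ZMod p) ^ (p ^ e - 1 - S.card) else 0) *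
        (if ∃ u ∈ S, x u = true then 1 else 0) else 0 := by
    intro S
    by_cases h1 : S ⊆ ch
    · by_cases h2 : S.card ≤ p ^ e - 1
      · simp only [h1, h2, true_and, if_true]
        -- For `S = ∅` there is no form of value 1, so the truncated exponent `0 - 1` in `formCoeff`
        -- is harmless.
        rw [← Finset.sum_filter, Finset.sum_const, card_forms_eq_one hq, nsmul_eq_mul]
        split_ifs with h
        · rw [formCoeff]
          have hq0 : (q : ZMod p) ≠ 0 := by
            rw [Ne, ZMod.natCast_eq_zero_iff]
            exact fun hd => hpq ((Nat.prime_dvd_prime_iff_eq hp hq).1 hd).symm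
          have := pow_ne_zero (S.card - 1) hq0
          push_cast
          field_simp
        · simp
      · simp [h2]
    · simp [h1]
  simp only [hsub]
  rw [← Finset.sum_filter]
  refine Finset.sum_congr ?_ fun _ _ => rfl
  ext S
  simp

end OrSum

/-! ### Layered circuits -/

/-- A finite layered directed graph whose sources are the variables in `X`. -/
structure Layering (X : Type) where
  Node : Type
  [fintypeNode : Fintype Node]
  Child : Node → Node → Prop
  level : Node → ℕ
  leaf : X → Node
  top : Node
  leaf_injective : Function.Injective leaf
  leaf_iff : ∀ v, (∃ x, leaf x = v) ↔ ∀ u, ¬ Child u v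
  level_child : ∀ {u v}, Child u v → level v = level u + 1
  level_leaf : ∀ x, level (leaf x) = 0

attribute [instance] Layering.fintypeNode

/-- For every prime `p` of `m`: another prime `q p` of `m`, an exponent `e p`, and wire
multiplicities `w p j` that represent the coefficients `formCoeff` modulo `p` and vanish modulo
the other primes. -/
structure ModWeights (m : ℕ) where
  q : ℕ → ℕ
  e : ℕ → ℕ
  w : ℕ → ℕ → ℕ
  nonempty : m.primeFactors.Nonempty
  q_prime : ∀ p, (q p).Prime
  q_dvd : ∀ {p}, p ∈ m.primeFactors → q p ∣ m
  q_ne : ∀ {p}, p ∈ m.primeFactors → q p ≠ p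
  e_pos : ∀ p, 0 < e p
  w_pos : ∀ {p}, p ∈ m.primeFactors → ∀ j, 0 < w p j
  w_le : ∀ {p}, p ∈ m.primeFactors → ∀ j, w p j ≤ 2 * m
  w_cast : ∀ {p}, p ∈ m.primeFactors → ∀ j,
    (w p j : ZMod p) = formCoeff p (q p) (p ^ e p - 1) j
  w_cast_ne : ∀ {p p'}, p ∈ m.primeFactors → p' ∈ m.primeFactors → p ≠ p' → ∀ j,
    (w p j : ZMod p') = 0

namespace ModWeights

variable {m : ℕ} (W : ModWeights m)

instance (p : ℕ) : NeZero (W.q p) := ⟨(W.q_prime p).ne_zero⟩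

end ModWeights

namespace Layering

variable {m : ℕ} {X : Type} (T : Layering X) (W : ModWeights m)

theorem level_eq_zero_iff (v : T.Node) : T.level v = 0 ↔ ∃ x, T.leaf x = v := by
  constructor
  · intro h
    rw [T.leaf_iff]
    intro u hu
    have := T.level_child hu
    omega
  · rintro ⟨x, rfl⟩
    exact T.level_leaf x

/-- Nonzero linear forms modulo `q p` in few sibling variables. -/
def Test : Type :=
  Σ p : m.primeFactors, {x : Finset T.Node × (T.Node → ZMod (W.q p)) //
    x.1.card ≤ p.1 ^ W.e p - 1 ∧ (∃ v, ∀ u ∈ x.1, T.Child u v) ∧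
      -- The zero form is excluded because its gate would have no incoming wires. The set is kept
      -- beside the form, which may vanish on part of it, since the weight depends on the size of
      -- the set.
      (∀ u, u ∉ x.1 → x.2 u = 0) ∧ x.2 ≠ 0}

noncomputable instance : Fintype (T.Test W) := by unfold Test; infer_instance

variable {T W}

theorem Test.exists_mem (t : T.Test W) : ∃ u ∈ t.2.1.1, t.2.1.2 u ≠ 0 := by
  obtain ⟨u, hu⟩ := Function.ne_iff.1 t.2.2.2.2.2
  refine ⟨u, ?_, hu⟩
  by_contra hc
  exact hu (t.2.2.2.2.1 u hc)

/-- Distance from the variables. -/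
noncomputable def rank : T.Node ⊕ T.Test W → ℕ :=
  Sum.elim (fun v => 2 * T.level v) fun t => t.2.1.1.sup fun u => 2 * T.level u + 1

theorem rank_test_eq {t : T.Test W} {u : T.Node} (hu : u ∈ t.2.1.1) :
    rank (Sum.inr t : T.Node ⊕ T.Test W) = 2 * T.level u + 1 := by
  obtain ⟨v, hv⟩ := t.2.2.2.1
  refine le_antisymm (Finset.sup_le fun u' hu' => ?_)
    (Finset.le_sup (f := fun u => 2 * T.level u + 1) hu)
  have h1 := T.level_child (hv u hu)
  have h2 := T.level_child (hv u' hu')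
  omega

variable (T W)

noncomputable def circuitWires : T.Node ⊕ T.Test W → T.Node ⊕ T.Test W → ℕ
  | Sum.inl u, Sum.inr t => (t.2.1.2 u).val
  | Sum.inr t, Sum.inl v => if ∀ u ∈ t.2.1.1, T.Child u v then W.w t.1 t.2.1.1.card else 0
  | _, _ => 0

/-- The number of children of a node. -/
noncomputable def arity (v : T.Node) : ℕ := (Finset.univ.filter fun u => T.Child u v).card

/-- By `sum_formCoeff` the input sum modulo `p` is the `altChoose` of the arity minus the indicator
that `p ^ e` divides the number of false children. The gate accepts iff all these indicators are 1.
-/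
noncomputable def nodeLabel (v : T.Node) : X ⊕ Set (ZMod m) :=
  if h : ∃ x, T.leaf x = v then Sum.inl h.choose
  else Sum.inr {z | ∀ p ∈ m.primeFactors,
    (z.cast : ZMod p) = altChoose (ZMod p) (p ^ W.e p - 1) (T.arity v) - 1}

noncomputable def circuitLabel : T.Node ⊕ T.Test W → X ⊕ Set (ZMod m) :=
  Sum.elim (T.nodeLabel W) fun t => Sum.inr {z | (z.cast : ZMod (W.q t.1)) = 1}

theorem nodeLabel_leaf (x : X) : T.nodeLabel W (T.leaf x) = Sum.inl x := by
  have h : ∃ y, T.leaf y = T.leaf x := ⟨x, rfl⟩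
  rw [nodeLabel, dif_pos h]
  exact congrArg _ (T.leaf_injective h.choose_spec)

theorem nodeLabel_of_not {v : T.Node} (h : ¬ ∃ x, T.leaf x = v) :
    T.nodeLabel W v = Sum.inr {z | ∀ p ∈ m.primeFactors,
      (z.cast : ZMod p) = altChoose (ZMod p) (p ^ W.e p - 1) (T.arity v) - 1} := dif_neg h

/-- Both acyclicity and the exact depth of the circuit rest on this. -/
theorem rank_lt_of_wires {g g' : T.Node ⊕ T.Test W} (h : 0 < T.circuitWires W g g') :
    rank g' = rank g + 1 := by
  rcases g with u | t <;> rcases g' with v | t'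
  · simp [circuitWires] at h
  · have hu : t'.2.1.2 u ≠ 0 := by
      intro hc
      simp [circuitWires, hc] at h
    have : u ∈ t'.2.1.1 := by
      by_contra hc
      exact hu (t'.2.2.2.2.1 u hc)
    rw [rank_test_eq this]
    rfl
  · simp only [circuitWires] at h
    split_ifs at h with hc
    · obtain ⟨u, hu, -⟩ := t.exists_mem
      rw [rank_test_eq hu]
      have := T.level_child (hc u hu)
      change 2 * T.level v = _
      omega
    · simp at h
  · simp [circuitWires] at h

/-- The form with the single variable `u`. -/
noncomputable def singleTest (p : m.primeFactors) {u v : T.Node} (h : T.Child u v) : T.Test W :=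
  ⟨p, ({u}, Pi.single u 1), by
    have h1 : p.1 ^ 1 ≤ p.1 ^ W.e p :=
      Nat.pow_le_pow_right (Nat.prime_of_mem_primeFactors p.2).pos (W.e_pos p)
    have h2 := (Nat.prime_of_mem_primeFactors p.2).two_le
    rw [pow_one] at h1
    simp only [Finset.card_singleton]
    omega, ⟨v, by simpa using h⟩, fun w hw => by
      simp only [Finset.mem_singleton] at hw
      simp [Pi.single_eq_of_ne hw], by
      have : Fact (W.q p).Prime := ⟨W.q_prime p⟩
      intro hc
      have := congrFun hc u
      simp at this⟩

theorem singleTest_wires (p : m.primeFactors) {u v : T.Node} (h : T.Child u v) :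
    0 < T.circuitWires W (Sum.inr (T.singleTest W p h)) (Sum.inl v) := by
  simp only [circuitWires]
  rw [if_pos (by simpa [singleTest] using h)]
  exact W.w_pos p.2 _

theorem exists_wires_test (t : T.Test W) :
    ∃ u ∈ t.2.1.1, 0 < T.circuitWires W (Sum.inl u) (Sum.inr t) := by
  obtain ⟨u, hu, hne⟩ := t.exists_mem
  refine ⟨u, hu, Nat.pos_of_ne_zero ?_⟩
  simp only [circuitWires]
  rwa [Ne, ZMod.val_eq_zero]

/-- Every node computes the conjunction of its children, through a layer of tests. -/
noncomputable def circuit : ModCircuit m X where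
  Gate := T.Node ⊕ T.Test W
  wires := T.circuitWires W
  label := T.circuitLabel W
  root := Sum.inl T.top
  acyclic := Subrelation.wf (fun {g g'} h => by
    have := T.rank_lt_of_wires W h
    change rank g < rank g'
    omega) (InvImage.wf rank wellFounded_lt)
  isInput_iff := by
    rintro (v | t)
    · constructor
      · rintro ⟨x, hx⟩ g
        have hv : ∃ x, T.leaf x = v := by
          by_contra hc
          simp only [circuitLabel, Sum.elim_inl] at hx
          rw [T.nodeLabel_of_not W hc] at hx
          simp at hx
        by_contra hc
        have := T.rank_lt_of_wires W (Nat.pos_of_ne_zero hc)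
        have h0 := (T.level_eq_zero_iff v).2 hv
        change 2 * T.level v = _ at this
        omega
      · intro h
        have hv : ∃ x, T.leaf x = v := by
          rw [T.leaf_iff]
          intro u hu
          obtain ⟨p, hp⟩ := W.nonempty
          have := T.singleTest_wires W ⟨p, hp⟩ hu
          rw [h] at this
          omega
        obtain ⟨x, rfl⟩ := hv
        exact ⟨x, T.nodeLabel_leaf W x⟩
    · constructor
      · rintro ⟨x, hx⟩
        simp [circuitLabel] at hx
      · intro h
        obtain ⟨u, -, hu⟩ := T.exists_wires_test W t
        rw [h] at hu
        omega
  existsUnique_input := by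
    intro x
    refine ⟨Sum.inl (T.leaf x), T.nodeLabel_leaf W x, ?_⟩
    rintro (v | t) hg
    · simp only [circuitLabel, Sum.elim_inl] at hg
      by_cases hv : ∃ y, T.leaf y = v
      · obtain ⟨y, rfl⟩ := hv
        rw [T.nodeLabel_leaf] at hg
        rw [Sum.inl_injective hg]
      · rw [T.nodeLabel_of_not W hv] at hg
        simp at hg
    · simp [circuitLabel] at hg

theorem circuit_depthAt (g : T.Node ⊕ T.Test W) : (T.circuit W).depthAt g = rank g := by
  induction hn : rank g using Nat.strong_induction_on generalizing g with
  | _ n ih =>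
  refine ((T.circuit W).depthAt_eq g).trans ?_
  apply le_antisymm
  · refine Finset.sup_le fun g' _ => ?_
    split_ifs with h
    · have h1 := T.rank_lt_of_wires W h
      rw [ih (rank g') (by omega) g' rfl]
      omega
    · exact Nat.zero_le _
  · rcases Nat.eq_zero_or_pos n with h0 | hpos
    · omega
    obtain ⟨g', hg'⟩ : ∃ g', 0 < T.circuitWires W g' g := by
      rcases g with v | t
      · have hv : ¬ ∃ x, T.leaf x = v := by
          rw [← T.level_eq_zero_iff]
          change 2 * T.level v = n at hn
          omega
        rw [T.leaf_iff] at hv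
        push Not at hv
        obtain ⟨u, hu⟩ := hv
        obtain ⟨p, hp⟩ := W.nonempty
        exact ⟨_, T.singleTest_wires W ⟨p, hp⟩ hu⟩
      · obtain ⟨u, -, hu⟩ := T.exists_wires_test W t
        exact ⟨_, hu⟩
    have h1 := T.rank_lt_of_wires W hg'
    have h2 := ih (rank g') (by omega) g' rfl
    refine le_trans ?_ (Finset.le_sup (f := fun g' : (T.circuit W).Gate =>
      if 0 < (T.circuit W).wires g' g then (T.circuit W).depthAt g' + 1 else 0)
      (Finset.mem_univ g'))
    have : 0 < (T.circuit W).wires g' g := hg'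
    rw [if_pos this, h2]
    omega

theorem circuit_depth : (T.circuit W).depth = 2 * T.level T.top := T.circuit_depthAt W _

theorem circuit_eval_leaf (a : X → Bool) (x : X) :
    (T.circuit W).eval a (Sum.inl (T.leaf x) : T.Node ⊕ T.Test W) = a x :=
  (T.circuit W).eval_input a (T.nodeLabel_leaf W x)

theorem circuit_eval_test (a : X → Bool) (t : T.Test W) :
    (T.circuit W).eval a (Sum.inr t : T.Node ⊕ T.Test W) = true ↔
      ∑ u : T.Node, t.2.1.2 u *
        (((T.circuit W).eval a (Sum.inl u : T.Node ⊕ T.Test W)).toNat : ZMod (W.q t.1)) = 1 := by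
  have hq : W.q t.1 ∣ m := W.q_dvd t.1.2
  have hl : (T.circuit W).label (Sum.inr t : T.Node ⊕ T.Test W) =
    Sum.inr {z | (z.cast : ZMod (W.q t.1)) = 1} := rfl
  rw [(T.circuit W).eval_mod a hl, Set.mem_ofPred_eq, ZMod.cast_natCast hq]
  have : (∑ g' : (T.circuit W).Gate, (T.circuit W).wires g' (Sum.inr t : T.Node ⊕ T.Test W) *
      ((T.circuit W).eval a g').toNat) = ∑ u : T.Node, (t.2.1.2 u).val *
        ((T.circuit W).eval a (Sum.inl u : T.Node ⊕ T.Test W)).toNat := by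
    refine (Fintype.sum_sum_type (α₁ := T.Node) (α₂ := T.Test W) _).trans ?_
    rw [Finset.sum_eq_zero (s := (Finset.univ : Finset (T.Test W))), add_zero]
    · rfl
    · intro t' _
      exact Nat.zero_mul _
  rw [this]
  push_cast
  simp only [ZMod.natCast_val, ZMod.cast_id', id_eq]

theorem circuit_eval_node (a : X → Bool) {v : T.Node} (hv : ¬ ∃ x, T.leaf x = v)
    (hbig : T.arity v < ∏ p ∈ m.primeFactors, p ^ W.e p) :
    (T.circuit W).eval a (Sum.inl v : T.Node ⊕ T.Test W) = true ↔
      ∀ u, T.Child u v → (T.circuit W).eval a (Sum.inl u : T.Node ⊕ T.Test W) = true := by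
  set x : T.Node → Bool := fun u => (T.circuit W).eval a (Sum.inl u : T.Node ⊕ T.Test W) with hx
  set ch : Finset T.Node := Finset.univ.filter fun u => T.Child u v with hch
  have hmem : ∀ u, u ∈ ch ↔ T.Child u v := fun u => by simp [hch]
  have hl : (T.circuit W).label (Sum.inl v : T.Node ⊕ T.Test W) = _ := T.nodeLabel_of_not W hv
  have hsum : (∑ g' : (T.circuit W).Gate, (T.circuit W).wires g' (Sum.inl v : T.Node ⊕ T.Test W) *
      ((T.circuit W).eval a g').toNat) = ∑ t : T.Test W,
        (if ∀ u ∈ t.2.1.1, T.Child u v then W.w t.1 t.2.1.1.card else 0) *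
        ((T.circuit W).eval a (Sum.inr t : T.Node ⊕ T.Test W)).toNat := by
    refine (Fintype.sum_sum_type (α₁ := T.Node) (α₂ := T.Test W) _).trans ?_
    rw [Finset.sum_eq_zero (s := (Finset.univ : Finset T.Node)), zero_add]
    · rfl
    · intro t' _
      exact Nat.zero_mul _
  -- Modulo `p` the weights of tests belonging to other primes vanish, and the remaining ones become
  -- the coefficients of `sum_formCoeff`.
  have hcast : ∀ p ∈ m.primeFactors, ((∑ g' : (T.circuit W).Gate,
      (T.circuit W).wires g' (Sum.inl v : T.Node ⊕ T.Test W) *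
      ((T.circuit W).eval a g').toNat : ℕ) : ZMod p) =
      altChoose (ZMod p) (p ^ W.e p - 1) (T.arity v) -
        if p ^ W.e p ∣ (ch.filter fun u => x u = false).card then 1 else 0 := by
    intro p hp
    rw [hsum, arity, ← hch, ← sum_formCoeff (Nat.prime_of_mem_primeFactors hp) (W.q_prime p)
      (W.q_ne hp) (W.e p) ch x]
    have h1 : (∑ t : T.Test W, (if ∀ u ∈ t.2.1.1, T.Child u v then W.w t.1 t.2.1.1.card else 0) *
        ((T.circuit W).eval a (Sum.inr t : T.Node ⊕ T.Test W)).toNat) =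
        ∑ p : m.primeFactors, ∑ y : {x : Finset T.Node × (T.Node → ZMod (W.q p)) //
          x.1.card ≤ p.1 ^ W.e p - 1 ∧ (∃ v, ∀ u ∈ x.1, T.Child u v) ∧
          (∀ u, u ∉ x.1 → x.2 u = 0) ∧ x.2 ≠ 0},
          (if ∀ u ∈ y.1.1, T.Child u v then W.w p y.1.1.card else 0) *
          ((T.circuit W).eval a (Sum.inr ⟨p, y⟩ : T.Node ⊕ T.Test W)).toNat :=
      Fintype.sum_sigma _
    rw [h1, Nat.cast_sum, Finset.sum_eq_single_of_mem (⟨p, hp⟩ : m.primeFactors)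
      (Finset.mem_univ _)]
    · rw [← Fintype.sum_prod_type' (f := fun (S : Finset T.Node) (a : T.Node → ZMod (W.q p)) =>
        if S.card ≤ p ^ W.e p - 1 ∧ S ⊆ ch ∧ (∀ u, u ∉ S → a u = 0) ∧
          ∑ u, a u * ((x u).toNat : ZMod (W.q p)) = 1
        then formCoeff p (W.q p) (p ^ W.e p - 1) S.card else 0)]
      rw [Nat.cast_sum]
      symm
      -- Pairs that are not tests contribute nothing, so the sum over all pairs reduces to the
      -- tests.
      have h2 : ∀ y : Finset T.Node × (T.Node → ZMod (W.q p)),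
          (if y.1.card ≤ p ^ W.e p - 1 ∧ y.1 ⊆ ch ∧ (∀ u, u ∉ y.1 → y.2 u = 0) ∧
            ∑ u, y.2 u * ((x u).toNat : ZMod (W.q p)) = 1
          then formCoeff p (W.q p) (p ^ W.e p - 1) y.1.card else 0) ≠ 0 →
          (y.1.card ≤ p ^ W.e p - 1 ∧ (∃ v, ∀ u ∈ y.1, T.Child u v) ∧
            (∀ u, u ∉ y.1 → y.2 u = 0) ∧ y.2 ≠ 0) := by
        intro y hy
        rw [ne_eq, ite_eq_right_iff, Classical.not_imp] at hy
        obtain ⟨⟨h3, h4, h5, h6⟩, -⟩ := hy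
        refine ⟨h3, ⟨v, fun u hu => (hmem u).1 (h4 hu)⟩, h5, ?_⟩
        rintro h7
        have : Fact (W.q p).Prime := ⟨W.q_prime p⟩
        simp [h7] at h6
      rw [← Finset.sum_filter_of_ne (fun y _ => h2 y), ← Finset.sum_subtype_eq_sum_filter]
      simp only [Finset.subtype_univ]
      refine Finset.sum_congr rfl fun y _ => ?_
      have h3 := T.circuit_eval_test W a ⟨⟨p, hp⟩, y⟩
      have h4 : (∀ u ∈ y.1.1, T.Child u v) ↔ y.1.1 ⊆ ch :=
        forall₂_congr fun u _ => (hmem u).symm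
      simp only [y.2.1, h4, true_and]
      by_cases h5 : y.1.1 ⊆ ch
      · by_cases h6 : ∑ u, y.1.2 u * ((x u).toNat : ZMod (W.q p)) = 1
        · rw [h3.2 h6, if_pos ⟨h5, y.2.2.2.1, h6⟩, if_pos h5]
          simp [W.w_cast hp]
        · have h7 : (T.circuit W).eval a (Sum.inr ⟨⟨p, hp⟩, y⟩ : T.Node ⊕ T.Test W) = false := by
            rw [← Bool.not_eq_true, h3]
            exact h6
          rw [h7, if_neg fun h => h6 h.2.2]
          simp
      · rw [if_neg fun h => h5 h.1, if_neg h5]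
        simp
    · intro p' _ hpp'
      rw [Nat.cast_sum]
      refine Finset.sum_eq_zero fun y _ => ?_
      have : p'.1 ≠ p := fun h => hpp' (Subtype.ext h)
      split_ifs
      · rw [Nat.cast_mul, W.w_cast_ne p'.2 hp this, zero_mul]
      · simp
  rw [(T.circuit W).eval_mod a hl, Set.mem_ofPred_eq]
  -- The prime powers are coprime and their product exceeds the arity, so the number of zeros is
  -- divisible by all of them only if it is 0.
  have hiff : (∀ p ∈ m.primeFactors, p ^ W.e p ∣ (ch.filter fun u => x u = false).card) ↔
      ∀ u, T.Child u v → x u = true := by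
    constructor
    · intro h
      have hd : ∏ p ∈ m.primeFactors, p ^ W.e p ∣ (ch.filter fun u => x u = false).card := by
        refine Finset.prod_dvd_of_isRelPrime (fun p hp p' hp' hne => ?_) h
        exact Nat.coprime_iff_isRelPrime.1 (Nat.Coprime.pow _ _ ((Nat.coprime_primes
          (Nat.prime_of_mem_primeFactors hp) (Nat.prime_of_mem_primeFactors hp')).2 hne))
      have h0 := Nat.eq_zero_of_dvd_of_lt hd ((Finset.card_filter_le _ _).trans_lt hbig)
      rw [Finset.card_eq_zero, Finset.filter_eq_empty_iff] at h0
      intro u hu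
      simpa using h0 ((hmem u).2 hu)
    · intro h p _
      have : (ch.filter fun u => x u = false) = ∅ := by
        rw [Finset.filter_eq_empty_iff]
        intro u hu
        simp [h u ((hmem u).1 hu)]
      simp [this]
  rw [← hiff]
  refine forall₂_congr fun p hp => ?_
  have : Fact p.Prime := ⟨Nat.prime_of_mem_primeFactors hp⟩
  rw [ZMod.cast_natCast (Nat.dvd_of_mem_primeFactors hp), hcast p hp]
  split_ifs with h
  · simp [h]
  · simp only [h, iff_false]
    intro hc
    exact one_ne_zero (α := ZMod p) (by linear_combination hc)

end Layering

/-! ### Symmetry and size of layered circuits. -/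

namespace Layering

variable {m : ℕ} {X : Type} (T : Layering X) (W : ModWeights m)

/-- An automorphism of the layering acts on the tests. -/
noncomputable def testPerm (φ : Equiv.Perm T.Node)
    (hφ : ∀ u v, T.Child (φ u) (φ v) ↔ T.Child u v) : Equiv.Perm (T.Test W) :=
  Equiv.sigmaCongrRight fun _ =>
    (Equiv.prodCongr φ.finsetCongr (φ.arrowCongr (Equiv.refl _))).subtypeEquiv fun x => by
      refine and_congr (by simp) (and_congr ?_ (and_congr ?_ ?_))
      · refine (φ.exists_congr_left).trans ?_
        constructor
        · rintro ⟨v, hv⟩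
          refine ⟨v, fun u hu => ?_⟩
          obtain ⟨w, hw, rfl⟩ := Finset.mem_map.1 hu
          have := hv w hw
          rw [← hφ] at this
          simpa using this
        · rintro ⟨v, hv⟩
          refine ⟨v, fun u hu => ?_⟩
          rw [← hφ]
          have := hv (φ u) (Finset.mem_map_of_mem _ hu)
          simpa using this
      · rw [φ.forall_congr_left]
        simp [Equiv.arrowCongr]
      · rw [not_iff_not]
        constructor
        · intro h
          ext u
          simp [Equiv.arrowCongr, h]
        · intro h
          ext u
          have := congrFun h (φ u)
          simpa [Equiv.arrowCongr] using this

theorem circuit_extends {π : Equiv.Perm X} (φ : Equiv.Perm T.Node)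
    (hφ : ∀ u v, T.Child (φ u) (φ v) ↔ T.Child u v) (hπ : ∀ x, φ (T.leaf x) = T.leaf (π x)) :
    ∃ σ, (T.circuit W).Extends π σ := by
  refine ⟨Equiv.sumCongr φ (T.testPerm W φ hφ), ?_, ?_⟩
  · rintro (v | t)
    · change T.nodeLabel W (φ v) = Sum.map π id (T.nodeLabel W v)
      by_cases hv : ∃ x, T.leaf x = v
      · obtain ⟨x, rfl⟩ := hv
        rw [hπ, T.nodeLabel_leaf, T.nodeLabel_leaf]
        rfl
      · have hv' : ¬ ∃ x, T.leaf x = φ v := by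
          rintro ⟨x, hx⟩
          refine hv ⟨π⁻¹ x, φ.injective ?_⟩
          rw [hπ]
          simpa using hx
        have har : T.arity (φ v) = T.arity v := by
          refine Eq.trans ?_ (Finset.card_map φ.toEmbedding)
          rw [arity]
          congr 1
          ext u
          simp only [Finset.mem_filter, Finset.mem_univ, true_and, Finset.mem_map_equiv]
          rw [← hφ (φ.symm u) v, Equiv.apply_symm_apply]
        rw [T.nodeLabel_of_not W hv, T.nodeLabel_of_not W hv', har]
        rfl
    · rfl
  · rintro (u | t) (v | t')
    · rfl
    · change ZMod.val (t'.2.1.2 (φ.symm (φ u))) = ZMod.val (t'.2.1.2 u)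
      rw [Equiv.symm_apply_apply]
    · change (if ∀ u ∈ t.2.1.1.map φ.toEmbedding, T.Child u (φ v) then
          W.w t.1 (t.2.1.1.map φ.toEmbedding).card else 0) =
        if ∀ u ∈ t.2.1.1, T.Child u v then W.w t.1 t.2.1.1.card else 0
      simp only [Finset.forall_mem_map, Equiv.coe_toEmbedding, hφ, Finset.card_map]
    · rfl

/-- Termwise comparison with the binomial expansion of the right-hand side. -/
theorem card_filter_card_le_le {N : Type*} [Fintype N] (D : ℕ) :
    (Finset.univ.filter fun S : Finset N => S.card ≤ D).card ≤ (Fintype.card N + 1) ^ D := by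
  have h1 : (Finset.univ.filter fun S : Finset N => S.card ≤ D) ⊆
      (Finset.range (D + 1)).biUnion fun j => Finset.univ.powersetCard j := by
    intro S hS
    simp only [Finset.mem_filter, Finset.mem_univ, true_and] at hS
    simp only [Finset.mem_biUnion, Finset.mem_range, Finset.mem_powersetCard]
    exact ⟨S.card, by omega, Finset.subset_univ _, rfl⟩
  refine (Finset.card_le_card h1).trans (Finset.card_biUnion_le.trans ?_)
  rw [add_pow]
  refine Finset.sum_le_sum fun j hj => ?_
  rw [Finset.card_powersetCard, Finset.card_univ, one_pow, mul_one]
  have h2 : 1 ≤ D.choose j := Nat.choose_pos (by have := Finset.mem_range.1 hj; omega)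
  exact (Nat.choose_le_pow _ _).trans (Nat.le_mul_of_pos_right _ h2)

theorem card_test_le {D : ℕ} (hm : m ≠ 0) (hD : ∀ p ∈ m.primeFactors, p ^ W.e p - 1 ≤ D) :
    Fintype.card (T.Test W) ≤
      m.primeFactors.card * ((Fintype.card T.Node + 1) * m) ^ D := by
  have h1 : Fintype.card (T.Test W) = ∑ p : m.primeFactors,
      Fintype.card {x : Finset T.Node × (T.Node → ZMod (W.q p)) //
        x.1.card ≤ p.1 ^ W.e p - 1 ∧ (∃ v, ∀ u ∈ x.1, T.Child u v) ∧
        (∀ u, u ∉ x.1 → x.2 u = 0) ∧ x.2 ≠ 0} := Fintype.card_sigma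
  rw [h1, ← Fintype.card_coe, ← Finset.card_univ, ← smul_eq_mul]
  refine Finset.sum_le_card_nsmul _ _ _ fun p _ => ?_
  rw [Fintype.card_subtype]
  have hqm : W.q p ≤ m := Nat.le_of_dvd (Nat.pos_of_ne_zero hm) (W.q_dvd p.2)
  have h2 : (Finset.univ.filter fun x : Finset T.Node × (T.Node → ZMod (W.q p)) =>
        x.1.card ≤ p.1 ^ W.e p - 1 ∧ (∃ v, ∀ u ∈ x.1, T.Child u v) ∧
        (∀ u, u ∉ x.1 → x.2 u = 0) ∧ x.2 ≠ 0) ⊆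
      (Finset.univ.filter fun S : Finset T.Node => S.card ≤ D).biUnion fun S =>
        (Finset.univ.filter fun a : T.Node → ZMod (W.q p) => ∀ u, u ∉ S → a u = 0).map
          ⟨fun a => (S, a), fun a b hab => (Prod.ext_iff.1 hab).2⟩ := by
    rintro ⟨S, a⟩ hx
    simp only [Finset.mem_filter, Finset.mem_univ, true_and] at hx
    simp only [Finset.mem_biUnion, Finset.mem_filter, Finset.mem_univ, true_and, Finset.mem_map]
    exact ⟨S, hx.1.trans (hD p p.2), a, hx.2.2.1, rfl⟩
  refine (Finset.card_le_card h2).trans (Finset.card_biUnion_le.trans ?_)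
  rw [mul_pow]
  refine (Finset.sum_le_card_nsmul _ _ (m ^ D) fun S hS => ?_).trans
    (Nat.mul_le_mul_right _ (card_filter_card_le_le D))
  rw [Finset.card_map, card_functions_supported]
  simp only [Finset.mem_filter, Finset.mem_univ, true_and] at hS
  exact (Nat.pow_le_pow_left hqm _).trans (Nat.pow_le_pow_right (Nat.pos_of_ne_zero hm) hS)

theorem circuitWires_le (hm : m ≠ 0) (g g' : T.Node ⊕ T.Test W) :
    T.circuitWires W g g' ≤ 2 * m := by
  rcases g with u | t <;> rcases g' with v | t'
  · exact Nat.zero_le _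
  · have h1 := ZMod.val_lt (t'.2.1.2 u)
    have h2 : W.q t'.1 ≤ m := Nat.le_of_dvd (Nat.pos_of_ne_zero hm) (W.q_dvd t'.1.2)
    simp only [circuitWires]
    omega
  · simp only [circuitWires]
    split_ifs
    · exact W.w_le t.1.2 _
    · exact Nat.zero_le _
  · exact Nat.zero_le _

theorem circuit_size_le {D : ℕ} (hm : m ≠ 0) (hpos : 0 < D)
    (hD : ∀ p ∈ m.primeFactors, p ^ W.e p - 1 ≤ D) :
    (T.circuit W).size ≤
      3 * m * ((m.primeFactors.card + 1) * ((Fintype.card T.Node + 1) * m) ^ D) ^ 2 := by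
  have hm1 : 1 ≤ m := Nat.pos_of_ne_zero hm
  have hG : Fintype.card (T.circuit W).Gate ≤
      (m.primeFactors.card + 1) * ((Fintype.card T.Node + 1) * m) ^ D := by
    have h1 : Fintype.card (T.circuit W).Gate =
        Fintype.card T.Node + Fintype.card (T.Test W) := Fintype.card_sum
    have h2 := T.card_test_le W hm hD
    have h3 : Fintype.card T.Node ≤ ((Fintype.card T.Node + 1) * m) ^ D :=
      calc Fintype.card T.Node ≤ Fintype.card T.Node + 1 := Nat.le_succ _
        _ ≤ (Fintype.card T.Node + 1) * m := Nat.le_mul_of_pos_right _ hm1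
        _ ≤ _ := Nat.le_self_pow hpos.ne' _
    rw [h1, add_mul, one_mul]
    omega
  have hW : ∑ g : (T.circuit W).Gate, ∑ g' : (T.circuit W).Gate, (T.circuit W).wires g g' ≤
      Fintype.card (T.circuit W).Gate * (Fintype.card (T.circuit W).Gate * (2 * m)) := by
    rw [← Finset.card_univ, ← smul_eq_mul, ← smul_eq_mul (Finset.card _) (2 * m)]
    refine Finset.sum_le_card_nsmul _ _ _ fun g _ => ?_
    refine Finset.sum_le_card_nsmul _ _ _ fun g' _ => ?_
    exact T.circuitWires_le W hm g g'
  have h0 : 0 < Fintype.card (T.circuit W).Gate := Fintype.card_pos_iff.2 ⟨(T.circuit W).root⟩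
  rw [ModCircuit.size]
  generalize Fintype.card (T.circuit W).Gate = G at *
  have hG2 := Nat.pow_le_pow_left hG 2
  calc G + _ ≤ G + G * (G * (2 * m)) := by omega
    _ ≤ 3 * m * G ^ 2 := by
      have h4 : G ≤ m * G ^ 2 := by
        calc G ≤ G ^ 2 := Nat.le_self_pow two_ne_zero _
          _ ≤ m * G ^ 2 := Nat.le_mul_of_pos_left _ hm1
      have h5 : G * (G * (2 * m)) = 2 * (m * G ^ 2) := by ring
      have h6 : 3 * m * G ^ 2 = 3 * (m * G ^ 2) := by ring
      omega
    _ ≤ _ := Nat.mul_le_mul_left _ hG2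

end Layering

/-! ### Existence of the wire weights. -/

/-- Suitable weights with prime powers slightly larger than `t`. -/
theorem exists_modWeights {m : ℕ} (hr : 2 ≤ m.primeFactors.card) {t : ℕ} (ht : 0 < t) :
    ∃ W : ModWeights m, ∀ p ∈ m.primeFactors, t < p ^ W.e p ∧ p ^ W.e p ≤ m * t := by
  have hm : m ≠ 0 := by rintro rfl; simp at hr
  have hq : ∀ p, ∃ q, q.Prime ∧ (p ∈ m.primeFactors → q ∣ m ∧ q ≠ p) := by
    intro p
    by_cases hp : p ∈ m.primeFactors
    · obtain ⟨q, hq, hne⟩ := Finset.exists_mem_ne (s := m.primeFactors) (by omega) p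
      exact ⟨q, Nat.prime_of_mem_primeFactors hq, fun _ => ⟨Nat.dvd_of_mem_primeFactors hq, hne⟩⟩
    · exact ⟨2, Nat.prime_two, fun h => absurd h hp⟩
  choose q hq1 hq2 using hq
  have hrad : ∏ p ∈ m.primeFactors, p ≤ m :=
    Nat.le_of_dvd (Nat.pos_of_ne_zero hm) (Nat.prod_primeFactors_dvd m)
  have hw : ∀ p j, ∃ w, p ∈ m.primeFactors → 0 < w ∧ w ≤ 2 * m ∧
      (w : ZMod p) = formCoeff p (q p) (p ^ (Nat.log p t + 1) - 1) j ∧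
      ∀ p' ∈ m.primeFactors, p ≠ p' → (w : ZMod p') = 0 := by
    intro p j
    by_cases hp : p ∈ m.primeFactors
    swap
    · exact ⟨0, fun h => absurd h hp⟩
    have hpp := Nat.prime_of_mem_primeFactors hp
    have : Fact p.Prime := ⟨hpp⟩
    set M := ∏ p' ∈ m.primeFactors.erase p, p' with hM
    have hMp : p * M ≤ m := (Finset.mul_prod_erase m.primeFactors (fun p => p) hp).trans_le hrad
    have hM0 : 0 < M := Finset.prod_pos fun p' hp' =>
      (Nat.prime_of_mem_primeFactors (Finset.mem_of_mem_erase hp')).pos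
    have hMc : (M : ZMod p) ≠ 0 := by
      rw [Ne, ZMod.natCast_eq_zero_iff, hM, hpp.prime.dvd_finsetProd_iff]
      rintro ⟨p', hp', hd⟩
      exact Finset.ne_of_mem_erase hp' ((Nat.prime_dvd_prime_iff_eq hpp
        (Nat.prime_of_mem_primeFactors (Finset.mem_of_mem_erase hp'))).1 hd).symm
    generalize formCoeff p (q p) (p ^ (Nat.log p t + 1) - 1) j = c
    -- The factor `M` kills the weight modulo the other primes. The summand `p` makes it positive
    -- without changing its residue modulo `p`, so that every intended wire is present.
    refine ⟨M * (((M : ZMod p)⁻¹ * c).val + p), fun _ => ⟨?_, ?_, ?_, ?_⟩⟩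
    · have := hpp.pos
      positivity
    · have h1 := ZMod.val_lt ((M : ZMod p)⁻¹ * c)
      calc M * (((M : ZMod p)⁻¹ * c).val + p) ≤ M * (p + p) :=
            Nat.mul_le_mul_left _ (by omega)
        _ = 2 * (p * M) := by ring
        _ ≤ 2 * m := Nat.mul_le_mul_left _ hMp
    · push_cast
      simp only [ZMod.natCast_val, ZMod.cast_id', id_eq, CharP.cast_eq_zero, add_zero]
      rw [← mul_assoc, mul_inv_cancel₀ hMc, one_mul]
    · intro p' hp' hne
      rw [ZMod.natCast_eq_zero_iff]
      exact (Finset.dvd_prod_of_mem (fun p => p)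
        (Finset.mem_erase.2 ⟨hne.symm, hp'⟩)).mul_right _
  choose w hw using hw
  refine ⟨⟨q, fun p => Nat.log p t + 1, w, Finset.card_pos.1 (by omega), hq1,
    fun hp => (hq2 _ hp).1, fun hp => (hq2 _ hp).2, fun _ => Nat.succ_pos _,
    fun hp j => (hw _ j hp).1, fun hp j => (hw _ j hp).2.1, fun hp j => (hw _ j hp).2.2.1,
    fun hp hp' hne j => (hw _ j hp).2.2.2 _ hp' hne⟩, fun p hp => ?_⟩
  have hpp := Nat.prime_of_mem_primeFactors hp
  refine ⟨Nat.lt_pow_succ_log_self hpp.one_lt t, ?_⟩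
  change p ^ (Nat.log p t + 1) ≤ m * t
  rw [pow_succ, mul_comm]
  exact Nat.mul_le_mul (Nat.le_of_dvd (Nat.pos_of_ne_zero hm) (Nat.dvd_of_mem_primeFactors hp))
    (Nat.pow_log_le_self p ht.ne')

/-! ### The circuit of the block tree. -/

namespace BlockTree

variable {h : ℕ} {k : Fin h → ℕ}

noncomputable instance : Fintype (BlockTree k) := by unfold BlockTree; infer_instance

theorem card_le (hk : ∀ i, 0 < k i) : Fintype.card (BlockTree k) ≤ (h + 1) * maxBlock k ^ h := by
  have h1 : Fintype.card (BlockTree k) = ∑ i : Fin (h + 1),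
      Fintype.card ((j : {j : Fin h // (i : ℕ) ≤ (j : ℕ)}) → Fin (k j.1)) := Fintype.card_sigma
  have h2 : (h + 1) * maxBlock k ^ h = (Finset.univ : Finset (Fin (h + 1))).card •
      maxBlock k ^ h := by simp
  rw [h1, h2]
  refine Finset.sum_le_card_nsmul _ _ _ fun i _ => ?_
  rw [Fintype.card_pi]
  simp only [Fintype.card_fin]
  have hle : ∀ j, k j ≤ maxBlock k := fun j => Finset.le_sup (Finset.mem_univ j)
  refine (Finset.prod_le_pow_card _ _ (maxBlock k) fun j _ => hle j.1).trans ?_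
  have hcard : (Finset.univ : Finset {j : Fin h // (i : ℕ) ≤ (j : ℕ)}).card ≤ h := by
    rw [Finset.card_univ]
    exact (Fintype.card_subtype_le _).trans (by simp)
  rcases Nat.eq_zero_or_pos h with rfl | hpos
  · have : (Finset.univ : Finset {j : Fin 0 // (i : ℕ) ≤ (j : ℕ)}).card = 0 := by omega
    rw [this]
  · exact Nat.pow_le_pow_right ((hk ⟨0, hpos⟩).trans_le (hle _)) hcard

theorem exists_isParent (hk : ∀ i, 0 < k i) {v : BlockTree k} (hv : (v.1 : ℕ) ≠ 0) :
    ∃ u, IsParent v u := by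
  obtain ⟨i, f⟩ := v
  have hi : (i : ℕ) ≠ 0 := hv
  refine ⟨⟨⟨i - 1, by omega⟩, fun j => if hj : (i : ℕ) ≤ (j.1 : ℕ) then f ⟨j.1, hj⟩
    else ⟨0, hk _⟩⟩, by simp only; omega, fun j hu hv => ?_⟩
  have : (i : ℕ) ≤ (j : ℕ) := hu
  simp [this]

theorem eq_ofLeaf {v : BlockTree k} (hv : (v.1 : ℕ) = 0) : ∃ x, ofLeaf x = v := by
  obtain ⟨⟨i, hi⟩, f⟩ := v
  obtain rfl : i = 0 := hv
  exact ⟨fun j => f ⟨j, Nat.zero_le _⟩, rfl⟩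

/-- The tree as a layering. -/
noncomputable def layering (k : Fin h → ℕ) (hk : ∀ i, 0 < k i) : Layering (Leaf k) where
  Node := BlockTree k
  Child u v := IsParent v u
  level v := v.1
  leaf := ofLeaf
  top := ⟨Fin.last h, fun j => absurd j.2 (not_le.2 j.1.2)⟩
  leaf_injective x y hxy := by
    have := eq_of_heq ((Sigma.mk.injEq _ _ _ _).mp hxy).2
    ext j
    have := congrFun this ⟨j, Nat.zero_le _⟩
    exact congrArg _ this
  leaf_iff v := by
    constructor
    · rintro ⟨x, rfl⟩ u hu
      have := hu.1
      simp [ofLeaf] at this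
    · intro hv
      refine eq_ofLeaf ?_
      by_contra hc
      obtain ⟨u, hu⟩ := exists_isParent hk hc
      exact hv u hu
  level_child hu := hu.1
  level_leaf _ := rfl

theorem arity_layering_le (hk : ∀ i, 0 < k i) (v : BlockTree k) :
    (layering k hk).arity v ≤ maxBlock k := by
  by_cases hv : (v.1 : ℕ) = 0
  · obtain ⟨x, rfl⟩ := eq_ofLeaf hv
    refine (Finset.card_eq_zero.2 ?_).trans_le (Nat.zero_le _)
    · rw [Finset.filter_eq_empty_iff]
      intro u _
      exact ((layering k hk).leaf_iff _).1 ⟨x, rfl⟩ u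
  · have hj : (v.1 : ℕ) - 1 < h := by have := v.1.2; omega
    refine le_trans ?_ (Finset.le_sup (f := k) (Finset.mem_univ ⟨(v.1 : ℕ) - 1, hj⟩))
    rw [← Fintype.card_fin (k _), ← Finset.card_univ]
    change (Finset.univ.filter fun u : BlockTree k => IsParent v u).card ≤ _
    have hle : ∀ u : BlockTree k, IsParent v u → (u.1 : ℕ) ≤ (v.1 : ℕ) - 1 := fun u hu => by
      have := hu.1; omega
    -- A child of `v` repeats the choices of `v` and adds a single one, which determines it.
    refine Finset.card_le_card_of_injOn (fun u : BlockTree k =>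
      if hu : IsParent v u then u.2 ⟨⟨(v.1 : ℕ) - 1, hj⟩, hle u hu⟩ else ⟨0, hk _⟩)
      (fun _ _ => Finset.mem_coe.2 (Finset.mem_univ _)) ?_
    intro u hu u' hu' he
    have hu : IsParent v u := (Finset.mem_filter.1 hu).2
    have hu' : IsParent v u' := (Finset.mem_filter.1 hu').2
    simp only [hu, hu', dif_pos] at he
    obtain ⟨⟨i, hi⟩, f⟩ := u
    obtain ⟨⟨i', hi'⟩, f'⟩ := u'
    have h1 := hu.1
    have h2 := hu'.1
    obtain rfl : i = i' := by simp only at h1 h2; omega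
    congr 1
    funext ⟨j, hij⟩
    by_cases hjv : (v.1 : ℕ) ≤ (j : ℕ)
    · exact (hu.2 j hjv hij).symm.trans (hu'.2 j hjv hij)
    · have : j = ⟨(v.1 : ℕ) - 1, hj⟩ := by
        apply Fin.ext
        simp only at h1 hij ⊢
        omega
      subst this
      exact he

theorem circuit_isBlockSymmetricAnd {m : ℕ} (W : ModWeights m) (hk : ∀ i, 0 < k i)
    (hbig : maxBlock k < ∏ p ∈ m.primeFactors, p ^ W.e p) :
    IsBlockSymmetricAnd ((layering k hk).circuit W) := by
  refine ⟨?_, fun a => ?_⟩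
  · rintro π ⟨φ, hφ⟩
    exact (layering k hk).circuit_extends W φ.toEquiv (fun u v => φ.map_rel_iff) hφ
  · have key : ∀ (n : ℕ) (v : BlockTree k), (v.1 : ℕ) = n →
        (((layering k hk).circuit W).eval a
          (Sum.inl v : BlockTree k ⊕ (layering k hk).Test W) = true ↔
        ∀ x : Leaf k, (∀ (j : Fin h) (hj : (v.1 : ℕ) ≤ (j : ℕ)), x j = v.2 ⟨j, hj⟩) →
          a x = true) := by
      intro n
      induction n with
      | zero =>
        intro v hv
        obtain ⟨x, rfl⟩ := eq_ofLeaf hv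
        refine (Bool.eq_iff_iff.1 ((layering k hk).circuit_eval_leaf W a x)).trans ?_
        constructor
        · intro hx y hy
          have : y = x := funext fun j => hy j (Nat.zero_le _)
          rwa [this]
        · intro hx
          exact hx x fun j _ => rfl
      | succ n ih =>
        intro v hv
        have hnl : ¬ ∃ x, (layering k hk).leaf x = v := by
          rintro ⟨x, rfl⟩
          exact absurd hv (Nat.succ_ne_zero n).symm
        refine ((layering k hk).circuit_eval_node W a hnl
          ((arity_layering_le hk v).trans_lt hbig)).trans ?_
        constructor
        · intro hall x hx
          have hn : n < h + 1 := by have := v.1.2; omega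
          let u : BlockTree k := ⟨⟨n, hn⟩, fun j => x j.1⟩
          have hu : IsParent v u := ⟨hv, fun j hj _ => (hx j hj).symm⟩
          exact (ih u rfl).1 (hall u hu) x fun j _ => rfl
        · intro hall u hu
          have hun : (u.1 : ℕ) = n := by have := hu.1; omega
          refine (ih u hun).2 fun x hx => hall x fun j hj => ?_
          have hj' : (u.1 : ℕ) ≤ (j : ℕ) := by omega
          rw [hx j hj', hu.2 j hj hj']
    refine (key h _ rfl).trans ⟨fun H x => H x fun j hj => ?_, fun H x _ => H x⟩
    exact absurd hj (not_le.2 j.2)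

theorem circuit_depth {m : ℕ} (W : ModWeights m) (hk : ∀ i, 0 < k i) :
    ((layering k hk).circuit W).depth = 2 * h := (layering k hk).circuit_depth W

end BlockTree

/-! ### Asymptotics -/

open scoped Nat in
/-- A quantity that dominates all `a!` with `a` at most a constant times `κ ^ (1 / r)` is at
least `2 ^ (c * κ ^ (1 / r) * log κ)`. -/
theorem exists_two_rpow_le_of_factorial_le {r A : ℕ} (hr : 0 < r) (hA : 0 < A) :
    ∃ c : ℝ, 0 < c ∧ ∀ κ G : ℕ, 2 ≤ κ → 2 ≤ G →
      (∀ a, 0 < a → (4 * a) ^ r * A ≤ κ → a ! ≤ G) →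
      (2 : ℝ) ^ (c * (κ : ℝ) ^ (1 / (r : ℝ)) * Real.logb 2 κ) ≤ G := by
  set B : ℝ := 4 * A with hB
  have hA1 : (1 : ℝ) ≤ A := by exact_mod_cast hA
  have hB1 : 4 ≤ B := by rw [hB]; linarith
  have hrR : (1 : ℝ) ≤ r := by exact_mod_cast hr
  set Y : ℝ := 36 * B ^ 2 with hY
  have hY1 : 1 ≤ Y := by rw [hY]; nlinarith
  -- The constant is so small that the exponent is at most 1 for `y < Y`, where `2 ≤ G` suffices.
  -- For `y ≥ Y` the factorial bound is applied with `a = ⌊y / B⌋`.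
  refine ⟨1 / (8 * r * Y ^ 2), by positivity, fun κ G hκ hG hfac => ?_⟩
  have hκ0 : (0 : ℝ) ≤ κ := Nat.cast_nonneg κ
  have hκ2 : (2 : ℝ) ≤ κ := by exact_mod_cast hκ
  set y : ℝ := (κ : ℝ) ^ (1 / (r : ℝ)) with hy
  have hy1 : 1 ≤ y := Real.one_le_rpow (by linarith) (by positivity)
  have hyr : y ^ r = κ := by
    rw [hy, ← Real.rpow_natCast, ← Real.rpow_mul hκ0, one_div,
      inv_mul_cancel₀ (by positivity), Real.rpow_one]
  have hL : Real.logb 2 κ = r * Real.logb 2 y := by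
    rw [← hyr, Real.logb_pow]
  have hly : 0 ≤ Real.logb 2 y := Real.logb_nonneg one_lt_two hy1
  have hGpos : (0 : ℝ) < G := by positivity
  rw [hL]
  by_cases hs : y < Y
  · have h1 : Real.logb 2 y ≤ 2 * y := by
      rw [Real.logb, div_le_iff₀ (Real.log_pos one_lt_two)]
      have h2 := Real.log_le_sub_one_of_pos (show 0 < y by linarith)
      have h3 := Real.log_two_gt_d9
      nlinarith
    have h2 : 1 / (8 * r * Y ^ 2) * y * (r * Real.logb 2 y) ≤ 1 := by
      rw [show 1 / (8 * r * Y ^ 2) * y * (r * Real.logb 2 y) =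
        (y * Real.logb 2 y) / (8 * Y ^ 2) by field_simp]
      rw [div_le_one (by positivity)]
      have h3 : y * Real.logb 2 y ≤ y * (2 * y) := mul_le_mul_of_nonneg_left h1 (by linarith)
      nlinarith
    calc (2 : ℝ) ^ (1 / (8 * r * Y ^ 2) * y * (r * Real.logb 2 y)) ≤ 2 ^ (1 : ℝ) :=
          Real.rpow_le_rpow_of_exponent_le one_le_two h2
      _ ≤ G := by rw [Real.rpow_one]; exact_mod_cast hG
  · push Not at hs
    set s : ℝ := y / B with hsdef
    have hys : y = B * s := by rw [hsdef]; field_simp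
    have hsB : 36 * B ≤ s := by
      rw [hsdef, le_div_iff₀ (by linarith)]
      rw [hY] at hs
      linarith
    set a := ⌊s⌋₊ with ha
    have has : (a : ℝ) ≤ s := Nat.floor_le (by linarith)
    have has2 : s / 2 ≤ a := by
      have := Nat.lt_floor_add_one s
      rw [← ha] at this
      linarith
    have ha0 : 0 < a := by
      have : (0 : ℝ) < a := by linarith
      exact_mod_cast this
    have hcond : (4 * a) ^ r * A ≤ κ := by
      have h1 : ((4 * a : ℕ) : ℝ) * A ≤ y := by
        push_cast
        rw [hys, hB]
        nlinarith
      have h2 : ((4 * a * A : ℕ) : ℝ) ^ r ≤ κ := by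
        rw [← hyr]
        push_cast at h1 ⊢
        exact pow_le_pow_left₀ (by positivity) h1 r
      have h3 : (4 * a * A) ^ r ≤ κ := by exact_mod_cast h2
      rw [mul_pow] at h3
      exact (Nat.mul_le_mul_left _ (Nat.le_self_pow hr.ne' A)).trans h3
    have hle := hfac a ha0 hcond
    have haR : (0 : ℝ) < a := by exact_mod_cast ha0
    have hlog : (a : ℝ) * (Real.log a - 1) ≤ Real.log G := by
      have h1 := Real.pow_div_factorial_le_exp (a : ℝ) haR.le a
      have h2 : ((a ! : ℕ) : ℝ) ≤ G := by exact_mod_cast hle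
      have h3 : (0 : ℝ) < (a ! : ℕ) := by exact_mod_cast Nat.factorial_pos a
      rw [div_le_iff₀ h3] at h1
      have h4 : (a : ℝ) ^ a ≤ Real.exp a * G :=
        h1.trans (mul_le_mul_of_nonneg_left h2 (Real.exp_pos _).le)
      have h5 := Real.log_le_log (by positivity) h4
      rw [Real.log_pow, Real.log_mul (Real.exp_pos _).ne' hGpos.ne', Real.log_exp] at h5
      linarith
    -- Since `a ≥ s / 2` and `e < 3`, the right side is at least `log (s / 6)`. From `s ≥ 36 * B`
    -- follow `s ≤ (s / 6) ^ 2` and `y ≤ s ^ 2`, each costing a factor 2.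
    have hlogs : Real.log y / 4 ≤ Real.log a - 1 := by
      have h1 : Real.log (s / 2) ≤ Real.log a := Real.log_le_log (by linarith) has2
      have h2 : Real.log (s / 2) = Real.log (s / 6) + Real.log 3 := by
        rw [← Real.log_mul (by linarith) (by norm_num)]
        congr 1
        ring
      have h3 : 1 ≤ Real.log 3 := by
        rw [Real.le_log_iff_exp_le (by norm_num)]
        exact Real.exp_one_lt_three.le
      have h4 : Real.log s ≤ 2 * Real.log (s / 6) := by
        have : Real.log s ≤ Real.log ((s / 6) ^ 2) :=
          Real.log_le_log (by linarith) (by nlinarith)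
        rwa [Real.log_pow] at this
      have h5 : Real.log y ≤ 2 * Real.log s := by
        have : Real.log y ≤ Real.log (s ^ 2) :=
          Real.log_le_log (by linarith) (by rw [hys]; nlinarith)
        rwa [Real.log_pow] at this
      linarith
    have hlogy : 0 ≤ Real.log y := Real.log_nonneg hy1
    have hfin : s / 8 * Real.log y ≤ Real.log G := by
      refine le_trans ?_ hlog
      calc s / 8 * Real.log y = s / 2 * (Real.log y / 4) := by ring
        _ ≤ a * (Real.log a - 1) := mul_le_mul has2 hlogs (by positivity) haR.le
    have hcoef : 1 / (8 * r * Y ^ 2) * y * (r * Real.logb 2 y) ≤ Real.logb 2 G := by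
      have h1 : 1 / (8 * r * Y ^ 2) * y * (r * Real.logb 2 y) = y / Y ^ 2 / 8 * Real.logb 2 y := by
        field_simp
      have h2 : y / Y ^ 2 ≤ s := by
        rw [hsdef]
        refine div_le_div_of_nonneg_left (by linarith) (by linarith) ?_
        rw [hY]
        nlinarith [mul_pos (show 0 < B by linarith) (show 0 < B by linarith)]
      rw [h1, Real.logb, Real.logb, ← mul_div_assoc]
      refine div_le_div_of_nonneg_right ?_ (Real.log_pos one_lt_two).le
      exact (mul_le_mul_of_nonneg_right (by linarith) hlogy).trans hfin
    rw [← Real.le_logb_iff_rpow_le one_lt_two hGpos]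
    exact hcoef

/-! ### Size bounds in terms of the largest block. -/

theorem pos_of_two_le_prod {h : ℕ} {k : Fin h → ℕ} (hk : 2 ≤ ∏ i, k i) (i : Fin h) : 0 < k i := by
  rcases Nat.eq_zero_or_pos (k i) with h0 | h0
  · rw [Finset.prod_eq_zero (Finset.mem_univ i) h0] at hk
    omega
  · exact h0

theorem prod_le_maxBlock_pow {h : ℕ} (k : Fin h → ℕ) : ∏ i, k i ≤ maxBlock k ^ h := by
  have := Finset.prod_le_pow_card (Finset.univ : Finset (Fin h)) k (maxBlock k)
    fun i hi => Finset.le_sup hi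
  simpa using this

theorem two_le_maxBlock {h : ℕ} {k : Fin h → ℕ} (hk : 2 ≤ ∏ i, k i) : 2 ≤ maxBlock k := by
  by_contra! hc
  have h1 := hk.trans (prod_le_maxBlock_pow k)
  have h2 : maxBlock k ^ h ≤ 1 ^ h := Nat.pow_le_pow_left (by omega) h
  rw [one_pow] at h2
  omega

theorem two_le_card_gate {m h : ℕ} {k : Fin h → ℕ} (hk : 2 ≤ ∏ i, k i)
    (D : ModCircuit m (BlockTree.Leaf k)) : 2 ≤ Fintype.card D.Gate := by
  choose f hf _ using D.existsUnique_input
  have h1 : Function.Injective f := fun x y hxy => by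
    have := hf x
    simp only [hxy, hf y] at this
    exact (Sum.inl_injective this).symm
  have h2 := Fintype.card_le_of_injective f h1
  rw [Fintype.card_pi] at h2
  simp only [Fintype.card_fin] at h2
  exact hk.trans h2

theorem exists_size_lower_bound {m r h : ℕ} (hmr : m.primeFactors.card = r) (hr : 2 ≤ r)
    (hh : 1 ≤ h) : ∃ c : ℝ, 0 < c ∧ ∀ k : Fin h → ℕ, 2 ≤ ∏ i, k i →
      ∀ D : ModCircuit m (BlockTree.Leaf k), IsBlockSymmetricAnd D →
        (2 : ℝ) ^ (c * (maxBlock k : ℝ) ^ (1 / (r : ℝ)) * Real.logb 2 (maxBlock k)) ≤ D.size := by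
  obtain ⟨c, hc, hlow⟩ := exists_two_rpow_le_of_factorial_le (r := r) (A := m ^ 3 + 1) (by omega)
    (by positivity)
  refine ⟨c, hc, fun k hk D hD => ?_⟩
  refine (hlow (maxBlock k) (Fintype.card D.Gate) (two_le_maxBlock hk) (two_le_card_gate hk D)
    fun a ha hak => ?_).trans ?_
  · exact factorial_le_card_gate (by omega) hh (pos_of_two_le_prod hk) ha (by rwa [hmr]) D hD
  · exact_mod_cast Nat.le_add_right _ _

theorem exists_size_upper_bound {m r h : ℕ} (hmr : m.primeFactors.card = r) (hr : 2 ≤ r) :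
    ∃ C : ℝ, 0 < C ∧ ∀ k : Fin h → ℕ, 2 ≤ ∏ i, k i →
      ∃ D : ModCircuit m (BlockTree.Leaf k), IsBlockSymmetricAnd D ∧ D.depth = 2 * h ∧
        (D.size : ℝ) ≤
          (2 : ℝ) ^ (C * (maxBlock k : ℝ) ^ (1 / (r : ℝ)) * Real.logb 2 (maxBlock k)) := by
  have hm : m ≠ 0 := by rintro rfl; simp at hmr; omega
  have hmpos : 0 < m := Nat.pos_of_ne_zero hm
  set A := 3 * m * (r + 1) ^ 2 with hA
  set B := (h + 2) * m with hB
  -- The factors `A` and `B` are moved into the exponent by the crude bounds `A ≤ 2 ^ A` and `B ≤ 2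
  -- ^ B`.
  refine ⟨(A + 2 * m * (B + h) : ℕ), by exact_mod_cast (by positivity), fun k hk => ?_⟩
  have hpos := pos_of_two_le_prod hk
  have hκ := two_le_maxBlock hk
  set κ := maxBlock k with hκdef
  have hκ0 : (0 : ℝ) ≤ κ := Nat.cast_nonneg κ
  have hκ2 : (2 : ℝ) ≤ κ := by exact_mod_cast hκ
  set y : ℝ := (κ : ℝ) ^ (1 / (r : ℝ)) with hy
  have hy1 : 1 ≤ y := Real.one_le_rpow (by linarith) (by positivity)
  have hrR : (0 : ℝ) < r := by exact_mod_cast (by omega : 0 < r)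
  have hyr : y ^ r = κ := by
    rw [hy, ← Real.rpow_natCast, ← Real.rpow_mul hκ0, one_div,
      inv_mul_cancel₀ hrR.ne', Real.rpow_one]
  set t := ⌊y⌋₊ with ht
  have ht0 : 0 < t := Nat.floor_pos.2 hy1
  have hty : (t : ℝ) ≤ y := Nat.floor_le (by linarith)
  obtain ⟨W, hW⟩ := exists_modWeights (by omega : 2 ≤ m.primeFactors.card) ht0
  -- Each of the `r` prime powers is at least `t + 1 > κ ^ (1 / r)`.
  have hbig : maxBlock k < ∏ p ∈ m.primeFactors, p ^ W.e p := by
    have h1 : κ < (t + 1) ^ r := by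
      have : (κ : ℝ) < ((t + 1 : ℕ) : ℝ) ^ r := by
        rw [← hyr]
        refine pow_lt_pow_left₀ ?_ (by linarith) (by omega)
        push_cast
        exact Nat.lt_floor_add_one y
      exact_mod_cast this
    refine h1.trans_le ?_
    rw [← hmr, ← Finset.prod_const]
    exact Finset.prod_le_prod' fun p hp => (hW p hp).1
  refine ⟨(BlockTree.layering k hpos).circuit W, BlockTree.circuit_isBlockSymmetricAnd W hpos hbig,
    BlockTree.circuit_depth W hpos, ?_⟩
  set L := Real.logb 2 κ with hL
  have hL1 : 1 ≤ L := by
    rw [hL, Real.le_logb_iff_rpow_le one_lt_two (by linarith), Real.rpow_one]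
    exact hκ2
  have hκL : (κ : ℝ) = 2 ^ L := (Real.rpow_logb two_pos (by norm_num) (by linarith)).symm
  have hsize := (BlockTree.layering k hpos).circuit_size_le W hm (D := m * t) (by positivity)
    fun p hp => (Nat.sub_le _ _).trans (hW p hp).2
  have hcard : Fintype.card (BlockTree.layering k hpos).Node ≤ (h + 1) * κ ^ h :=
    BlockTree.card_le hpos
  have hbase : (Fintype.card (BlockTree.layering k hpos).Node + 1) * m ≤ B * κ ^ h := by
    have h1 : 1 ≤ κ ^ h := Nat.one_le_pow _ _ (by omega)
    calc _ ≤ ((h + 1) * κ ^ h + κ ^ h) * m := Nat.mul_le_mul_right _ (by omega)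
      _ = B * κ ^ h := by rw [hB]; ring
  have hsize2 : ((BlockTree.layering k hpos).circuit W).size ≤
      2 ^ A * (2 ^ B * κ ^ h) ^ (2 * m * t) := by
    refine hsize.trans ?_
    calc 3 * m * ((m.primeFactors.card + 1) *
          ((Fintype.card (BlockTree.layering k hpos).Node + 1) * m) ^ (m * t)) ^ 2
        ≤ 3 * m * ((r + 1) * (2 ^ B * κ ^ h) ^ (m * t)) ^ 2 := by
          rw [hmr]
          have hbase' := hbase.trans (Nat.mul_le_mul_right (κ ^ h) (Nat.lt_two_pow_self (n := B)).le)
          exact Nat.mul_le_mul_left _ (Nat.pow_le_pow_left (Nat.mul_le_mul_left _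
            (Nat.pow_le_pow_left hbase' _)) 2)
      _ = A * (2 ^ B * κ ^ h) ^ (2 * m * t) := by rw [hA]; ring
      _ ≤ _ := Nat.mul_le_mul_right _ Nat.lt_two_pow_self.le
  have hreal : (((BlockTree.layering k hpos).circuit W).size : ℝ) ≤
      2 ^ (A : ℝ) * (2 ^ (B : ℝ) * (2 ^ L) ^ (h : ℝ)) ^ ((2 * m * t : ℕ) : ℝ) := by
    rw [← hκL]
    simp only [Real.rpow_natCast]
    exact_mod_cast hsize2
  refine hreal.trans ?_
  rw [← Real.rpow_mul zero_le_two, ← Real.rpow_add two_pos, ← Real.rpow_mul zero_le_two,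
    ← Real.rpow_add two_pos]
  refine Real.rpow_le_rpow_of_exponent_le one_le_two ?_
  push_cast
  have hyL : 1 ≤ y * L := one_le_mul_of_one_le_of_one_le hy1 hL1
  have hA0 : (0 : ℝ) ≤ A := Nat.cast_nonneg _
  have hB0 : (0 : ℝ) ≤ B := Nat.cast_nonneg _
  have hm0 : (0 : ℝ) ≤ m := Nat.cast_nonneg _
  have hh0 : (0 : ℝ) ≤ h := Nat.cast_nonneg _
  have h1 : (A : ℝ) ≤ A * (y * L) := le_mul_of_one_le_right hA0 hyL
  have h2 : (B + L * h : ℝ) ≤ (B + h) * L := by nlinarith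
  have h3 : (B + L * h : ℝ) * (2 * m * t) ≤ ((B + h) * L) * (2 * m * y) := by
    gcongr
  calc (A : ℝ) + (B + L * h) * (2 * m * t) ≤ A * (y * L) + ((B + h) * L) * (2 * m * y) :=
        add_le_add h1 h3
    _ = _ := by ring

theorem rpow_le_maxBlock {h : ℕ} (hh : 1 ≤ h) (k : Fin h → ℕ) :
    ((∏ i, k i : ℕ) : ℝ) ^ (1 / (h : ℝ)) ≤ maxBlock k := by
  have h1 : ((∏ i, k i : ℕ) : ℝ) ≤ (maxBlock k : ℝ) ^ h := by
    exact_mod_cast prod_le_maxBlock_pow k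
  have h2 := Real.rpow_le_rpow (Nat.cast_nonneg _) h1 (show 0 ≤ 1 / (h : ℝ) by positivity)
  rwa [one_div, Real.pow_rpow_inv_natCast (Nat.cast_nonneg _) (by omega), ← one_div] at h2

theorem maxBlock_eq_iff {h : ℕ} (hh : 1 ≤ h) {k : Fin h → ℕ} (hk : 2 ≤ ∏ i, k i) :
    (maxBlock k : ℝ) = ((∏ i, k i : ℕ) : ℝ) ^ (1 / (h : ℝ)) ↔
      ∀ i, (k i : ℝ) = ((∏ i, k i : ℕ) : ℝ) ^ (1 / (h : ℝ)) := by
  constructor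
  · intro he i
    rw [← he]
    have hle : ∀ j ∈ Finset.univ, k j ≤ maxBlock k := fun j hj => Finset.le_sup hj
    have hpow : maxBlock k ^ h = ∏ i, k i := by
      have : (maxBlock k : ℝ) ^ h = ((∏ i, k i : ℕ) : ℝ) := by
        rw [he, one_div, Real.rpow_inv_natCast_pow (Nat.cast_nonneg _) (by omega)]
      exact_mod_cast this
    by_contra hne
    have hlt : k i < maxBlock k := lt_of_le_of_ne (hle i (Finset.mem_univ i)) fun hc =>
      hne (by rw [hc])
    have := Finset.prod_lt_prod (fun j _ => pos_of_two_le_prod hk j) hle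
      ⟨i, Finset.mem_univ i, hlt⟩
    simp only [Finset.prod_const, Finset.card_univ, Fintype.card_fin] at this
    omega
  · intro hall
    obtain ⟨j, hj⟩ := exists_eq_maxBlock hh k
    rw [← hj, hall j]

theorem prod_eq_of_forall_eq_rpow {n h : ℕ} (hh : 1 ≤ h) {k : Fin h → ℕ}
    (hk : ∀ i, (k i : ℝ) = (n : ℝ) ^ (1 / (h : ℝ))) : ∏ i, k i = n := by
  have : ((∏ i, k i : ℕ) : ℝ) = n := by
    push_cast
    rw [Finset.prod_congr rfl fun i _ => hk i, Finset.prod_const, Finset.card_univ,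
      Fintype.card_fin, one_div, Real.rpow_inv_natCast_pow (Nat.cast_nonneg _) (by omega)]
  exact_mod_cast this

/-! ### The main theorem. -/

theorem mainTheorem3 (m r h : ℕ) (hmr : m.primeFactors.card = r) (hr : 2 ≤ r) (hh : 1 ≤ h) :
    ∃ c C K : ℝ, 0 < c ∧ 0 < C ∧ 0 < K ∧
      -- for every choice of block sizes, the optimal size is governed by the largest block
      (∀ k : Fin h → ℕ, 2 ≤ ∏ i, k i →
        (∀ D : ModCircuit m (BlockTree.Leaf k), IsBlockSymmetricAnd D →
          (2 : ℝ) ^ (c * (maxBlock k : ℝ) ^ (1 / (r : ℝ)) * Real.logb 2 (maxBlock k)) ≤ D.size) ∧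
        (∃ D : ModCircuit m (BlockTree.Leaf k), IsBlockSymmetricAnd D ∧ D.depth = 2 * h ∧
          (D.size : ℝ) ≤
            (2 : ℝ) ^ (C * (maxBlock k : ℝ) ^ (1 / (r : ℝ)) * Real.logb 2 (maxBlock k)))) ∧
      -- the largest block is smallest exactly if all blocks have size `n ^ (1 / h)`
      (∀ (n : ℕ) (k : Fin h → ℕ), 2 ≤ n → ∏ i, k i = n →
        (n : ℝ) ^ (1 / (h : ℝ)) ≤ maxBlock k ∧
        ((maxBlock k : ℝ) = (n : ℝ) ^ (1 / (h : ℝ)) ↔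
          ∀ i, (k i : ℝ) = (n : ℝ) ^ (1 / (h : ℝ)))) ∧
      -- no choice of block sizes beats the bound attained by equal block sizes
      (∀ (n : ℕ) (k : Fin h → ℕ), 2 ≤ n → ∏ i, k i = n →
        ∀ D : ModCircuit m (BlockTree.Leaf k), IsBlockSymmetricAnd D →
          (2 : ℝ) ^ (c * (n : ℝ) ^ (1 / ((h : ℝ) * r)) * Real.logb 2 n) ≤ D.size) ∧
      -- equal block sizes attain it, in depth `2 * h`
      (∀ (n : ℕ) (k : Fin h → ℕ), 2 ≤ n → (∀ i, (k i : ℝ) = (n : ℝ) ^ (1 / (h : ℝ))) →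
        ∃ D : ModCircuit m (BlockTree.Leaf k), IsBlockSymmetricAnd D ∧ D.depth = 2 * h ∧
          (2 : ℝ) ^ (c * (n : ℝ) ^ (1 / ((h : ℝ) * r)) * Real.logb 2 n) ≤ D.size ∧
          (D.size : ℝ) ≤ (2 : ℝ) ^ (C * (n : ℝ) ^ (1 / ((h : ℝ) * r)) * Real.logb 2 n) ∧
          ∀ k' : Fin h → ℕ, ∏ i, k' i = n →
            ∀ E : ModCircuit m (BlockTree.Leaf k'), IsBlockSymmetricAnd E →
              (D.size : ℝ) ≤ (E.size : ℝ) ^ K) := by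
  obtain ⟨c, hc, hlow⟩ := exists_size_lower_bound (h := h) hmr hr hh
  obtain ⟨C, hC, hup⟩ := exists_size_upper_bound (h := h) hmr hr
  have hhR : (1 : ℝ) ≤ h := by exact_mod_cast hh
  -- In terms of `n` only `log κ ≥ log n / h` is available, so the lower bounds share the smaller
  -- constant `c / h`.
  have hch : c / h ≤ c := div_le_self hc.le hhR
  have hch0 : 0 < c / h := by positivity
  have hpart₁ : ∀ k : Fin h → ℕ, 2 ≤ ∏ i, k i → ∀ D : ModCircuit m (BlockTree.Leaf k),
      IsBlockSymmetricAnd D → (2 : ℝ) ^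
        (c / h * (maxBlock k : ℝ) ^ (1 / (r : ℝ)) * Real.logb 2 (maxBlock k)) ≤ D.size := by
    intro k hk D hD
    refine le_trans (Real.rpow_le_rpow_of_exponent_le one_le_two ?_) (hlow k hk D hD)
    have h1 : 0 ≤ Real.logb 2 (maxBlock k) := Real.logb_nonneg one_lt_two (by
      exact_mod_cast (two_le_maxBlock hk).trans' one_le_two)
    gcongr
  have hpart₃ : ∀ (n : ℕ) (k : Fin h → ℕ), 2 ≤ n → ∏ i, k i = n →
      ∀ D : ModCircuit m (BlockTree.Leaf k), IsBlockSymmetricAnd D →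
        (2 : ℝ) ^ (c / h * (n : ℝ) ^ (1 / ((h : ℝ) * r)) * Real.logb 2 n) ≤ D.size := by
    rintro n k hn rfl D hD
    refine le_trans (Real.rpow_le_rpow_of_exponent_le one_le_two ?_) (hlow k hn D hD)
    set n := ∏ i, k i with hndef
    have hn1 : (1 : ℝ) < n := by exact_mod_cast hn
    have h1 := rpow_le_maxBlock hh k
    rw [← hndef] at h1
    have hp : (0 : ℝ) < (n : ℝ) ^ (1 / (h : ℝ)) := by positivity
    have h2 : (n : ℝ) ^ (1 / ((h : ℝ) * r)) ≤ (maxBlock k : ℝ) ^ (1 / (r : ℝ)) := by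
      rw [← one_div_mul_one_div, Real.rpow_mul (by linarith)]
      exact Real.rpow_le_rpow hp.le h1 (by positivity)
    have h3 : Real.logb 2 n / h ≤ Real.logb 2 (maxBlock k) := by
      have := Real.logb_le_logb_of_le one_lt_two hp h1
      rw [Real.logb_rpow_eq_mul_logb_of_pos (by linarith)] at this
      rwa [one_div_mul_eq_div] at this
    have h4 : 0 ≤ Real.logb 2 n := Real.logb_nonneg one_lt_two hn1.le
    calc c / h * (n : ℝ) ^ (1 / ((h : ℝ) * r)) * Real.logb 2 n
        = c * (n : ℝ) ^ (1 / ((h : ℝ) * r)) * (Real.logb 2 n / h) := by ring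
      _ ≤ _ := by gcongr
  -- `K` is the ratio of the exponents in the upper bound for `D` and the lower bound for `E`.
  refine ⟨c / h, C, C / (c / h), hch0, hC, by positivity, fun k hk => ⟨hpart₁ k hk, hup k hk⟩,
    ?_, hpart₃, ?_⟩
  · rintro n k hn rfl
    exact ⟨rpow_le_maxBlock hh k, maxBlock_eq_iff hh hn⟩
  · intro n k hn hk
    have hprod := prod_eq_of_forall_eq_rpow hh hk
    obtain ⟨D, hD, hdepth, hsize⟩ := hup k (by omega)
    have hn1 : (1 : ℝ) < n := by exact_mod_cast hn
    have hmax : (maxBlock k : ℝ) = (n : ℝ) ^ (1 / (h : ℝ)) := by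
      obtain ⟨j, hj⟩ := exists_eq_maxBlock hh k
      rw [← hj, hk j]
    have hlogn : 0 ≤ Real.logb 2 n := Real.logb_nonneg one_lt_two hn1.le
    have hsize' : (D.size : ℝ) ≤
        (2 : ℝ) ^ (C * (n : ℝ) ^ (1 / ((h : ℝ) * r)) * Real.logb 2 n) := by
      refine hsize.trans (Real.rpow_le_rpow_of_exponent_le one_le_two ?_)
      rw [hmax, ← Real.rpow_mul (by linarith), one_div_mul_one_div,
        Real.logb_rpow_eq_mul_logb_of_pos (by linarith)]
      have h1 : 1 / (h : ℝ) * Real.logb 2 n ≤ Real.logb 2 n :=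
        mul_le_of_le_one_left hlogn (by rw [div_le_one (by linarith)]; exact hhR)
      gcongr
    refine ⟨D, hD, hdepth, hpart₃ n k hn hprod D hD, hsize', fun k' hk' E hE => hsize'.trans ?_⟩
    have h1 := Real.rpow_le_rpow (by positivity) (hpart₃ n k' hn hk' E hE)
      (show 0 ≤ C / (c / h) by positivity)
    rw [← Real.rpow_mul zero_le_two] at h1
    refine le_trans (le_of_eq ?_) h1
    congr 1
    field_simp
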